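/- For $\tau$ in the upper half-plane $\mathbb H$ let $\Lambda_\tau=\mathbb Z+\mathbb Z\tau$ and $E_\tau=\mathbb C/\Lambda_\tau$. Let $k\in\mathbb Z$ and let $\Phi(z;\tau)$ be a meromorphic function on $\mathbb C\times\mathbb H$ whose polar set contains no fibre $\mathbb C\times\{\tau\}$ (so that $\Phi(-;\tau)$ is a meromorphic function for each $\tau$). Assume that $\Phi$ is elliptic, $\Phi(z+\lambda;\tau)=\Phi(z;\tau)$ for all $\lambda\in\Lambda_\tau$, and modular of weight $k$, $\Phi\big(\tfrac{z}{c\tau+d};\tfrac{a\tau+b}{c\tau+d}\big)=(c\tau+d)^k\,\Phi(z;\tau)$ for all $\begin{pmatrix}a&b\\c&d\end{pmatrix}\in\mathrm{SL}_2(\mathbb Z)$, and that for each $\tau$ the differential $\varphi=\Phi(z;\tau)\,dz$ on $E_\tau$ is of the second kind, i.e. has zero residue at every point. Definitions. (i) $\int_A\varphi$ is the integral of $\varphi$ along a closed piecewise differentiable curve on $E_\tau$ in the $A$-cycle class (its lift to $\mathbb C$ ends at its starting point plus $1$) which avoids the poles of $\varphi$. (ii) $\langle\varphi,dz\rangle_{\mathrm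 P}=\sum_{p\in E_\tau}\operatorname{Res}_p\big((\textstyle\int\varphi)\,dz\big)$, where $\int\varphi$ is a local primitive of $\varphi$ near $p$, is the Poincaré residue pairing. (iii) For a $2$-form $\omega$ on $E_\tau$ that is smooth away from a finite set $D$ and is locally a smooth form divided by a power of $z-p$ at each $p\in D$, the regularized integral is $\mathrm{Reg}\!\!\int_{E_\tau}\omega:=\int_{E_\tau}\alpha$ for any decomposition $\omega=\alpha+\partial\beta$, where $\alpha$ is a $2$-form with at most simple poles along $D$ and $\beta$ is a $(0,1)$-form with poles of arbitrary order along $D$ (poles in the sense just described). (iv) A holomorphic function $f$ on $\mathbb H$ is quasi-modular of weight $k$ if there are $\ell\ge 0$ and holomorphic functions $f_1,\dots,f_\ell$ on $\mathbb H$ with $$f\Big(\frac{a\tau+b}{c\tau+d}\Big)=(c\tau+d)^k f(\tau)+\sum_{i=1}^{\ell}c^{i}(c\tau+d)^{k-i}f_i(\tau)\qquad\text{for all }\begin{pmatrix}a&b\\c&d\end{pmatrix}\in\mathrm{SL}_2(\mathbb Z).$$ (v) A modular completion of such an $f$ is a function $F=\sum_{i=0}^{N}F_i/(\operatorname{Im}\tau)^i$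 with $F_i$ holomorphic on $\mathbb H$, $F_0=f$ and $F(\gamma\tau)=(c\tau+d)^kF(\tau)$ for all $\gamma=\begin{pmatrix}a&b\\c&d\end{pmatrix}\in\mathrm{SL}_2(\mathbb Z)$. Then $\int_A\varphi$ is well defined (representatives exist and all give the same value), the regularized integral of $\frac{d^2z}{\operatorname{Im}\tau}\Phi$ over $E_\tau$, with $d^2z=\frac i2\,dz\wedge d\bar z$, is well defined (decompositions exist, and for each of them $\int_{E_\tau}\alpha$ converges absolutely to the same value), and, as functions of $\tau\in\mathbb H$, $\int_A\varphi$ is quasi-modular of weight $k$ with modular completion $$\mathrm{Reg}\!\!\int_{E_\tau}\frac{d^2z}{\operatorname{Im}\tau}\,\Phi=\int_A\varphi-\frac{2\pi i}{2i\operatorname{Im}\tau}\,\langle\varphi,dz\rangle_{\mathrm P}.$$ -/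

import Mathlib

open scoped ContDiff Topology Manifold

noncomputable section

namespace RegInt

/-! ### Elliptic and modular meromorphic functions on `ℂ × ℍ` -/

/-- The automorphy factor `c τ + d`. -/
def autFactor (γ : Matrix.SpecialLinearGroup (Fin 2) ℤ) (τ : UpperHalfPlane) : ℂ :=
  ((γ 1 0 : ℤ) : ℂ) * (τ : ℂ) + ((γ 1 1 : ℤ) : ℂ)

/-- `Φ` is a meromorphic function on `ℂ × ℍ` which defines a meromorphic function `Φ(-; τ)` for
each `τ ∈ ℍ`: near every point `(z₀, τ₀)` it is a quotient `g / h` of two functions holomorphic in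
`(z, τ)`, where `h (-, τ₀)` does not vanish identically near `z₀`. The values of `Φ` at the zeros
of `h` are arbitrary, as usual for a meromorphic function written as a total function. -/
def IsMeromorphicFamily (Φ : ℂ → UpperHalfPlane → ℂ) : Prop :=
  ∀ (z₀ : ℂ) (τ₀ : UpperHalfPlane), ∃ g h : ℂ × ℂ → ℂ,
    AnalyticAt ℂ g (z₀, (τ₀ : ℂ)) ∧ AnalyticAt ℂ h (z₀, (τ₀ : ℂ)) ∧
    (∀ᶠ z in 𝓝[≠] z₀, h (z, (τ₀ : ℂ)) ≠ 0) ∧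
    ∀ᶠ q : ℂ × UpperHalfPlane in 𝓝 (z₀, τ₀),
      h (q.1, (q.2 : ℂ)) ≠ 0 → Φ q.1 q.2 = g (q.1, (q.2 : ℂ)) / h (q.1, (q.2 : ℂ))

/-- Invariance of a function on `ℂ` under the lattice `Λ_τ = ℤ + ℤ τ`. Such functions are the
functions on `E_τ = ℂ / Λ_τ`. -/
def IsLatticePeriodic (τ : UpperHalfPlane) (f : ℂ → ℂ) : Prop :=
  ∀ (m n : ℤ) (z : ℂ), f (z + ((m : ℂ) + (n : ℂ) * (τ : ℂ))) = f z

/-- `Φ` is elliptic. -/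
def IsElliptic (Φ : ℂ → UpperHalfPlane → ℂ) : Prop :=
  ∀ τ : UpperHalfPlane, IsLatticePeriodic τ (fun z => Φ z τ)

/-- `Φ` is modular of weight `k`: `Φ(z / (cτ+d); γ τ) = (cτ+d)^k Φ(z; τ)`. -/
def IsModularFamily (k : ℤ) (Φ : ℂ → UpperHalfPlane → ℂ) : Prop :=
  ∀ (γ : Matrix.SpecialLinearGroup (Fin 2) ℤ) (z : ℂ) (τ : UpperHalfPlane),
    Φ (z / autFactor γ τ) (γ • τ) = autFactor γ τ ^ k * Φ z τ

/-- The points where a function fails to be holomorphic: for a meromorphic function these are its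
poles (together with removable points at which the total function has the wrong value). -/
def singularSet (φ : ℂ → ℂ) : Set ℂ := {z | ¬ AnalyticAt ℂ φ z}

/-! ### Residues and second kind differentials -/

/-- The residue at `p` of the differential `φ dz`,
`(1 / 2πi) lim_{ε → 0+} ∮_{|z - p| = ε} φ dz`. -/
def residue (φ : ℂ → ℂ) (p : ℂ) : ℂ :=
  Filter.limUnder (𝓝[>] (0 : ℝ)) (fun ε : ℝ => (2 * Real.pi * Complex.I)⁻¹ * ∮ z in C(p, ε), φ z)

/-- The meromorphic differential `φ dz` has no residue at any point. -/
def IsSecondKind (φ : ℂ → ℂ) : Prop := ∀ p : ℂ, residue φ p = 0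

/-! ### The fundamental parallelogram and the Poincaré residue pairing -/

/-- The half-open fundamental parallelogram with sides `1` and `τ`, which represents every point of
`E_τ` exactly once. -/
def parallelogram (τ : UpperHalfPlane) : Set ℂ :=
  {z | ∃ x ∈ Set.Ico (0 : ℝ) 1, ∃ y ∈ Set.Ico (0 : ℝ) 1, z = (x : ℂ) + (y : ℂ) * (τ : ℂ)}

/-- `G` is a primitive of `φ dz` on a punctured neighbourhood of `p`. -/
def IsLocalPrimitive (φ : ℂ → ℂ) (p : ℂ) (G : ℂ → ℂ) : Prop :=
  ∀ᶠ z in 𝓝[≠] p, HasDerivAt G (φ z) z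

open Classical in
/-- A local primitive of `φ dz` near `p`, unique up to a constant. It exists when `φ dz` has no
residue at `p` (otherwise the value `0` is returned). -/
def localPrimitive (φ : ℂ → ℂ) (p : ℂ) : ℂ → ℂ :=
  if h : ∃ G, IsLocalPrimitive φ p G then h.choose else 0

/-- The Poincaré residue pairing `⟨φ dz, ψ dz⟩_P = ∑_{p ∈ E_τ} Res_p ((∫ φ dz) ψ dz)` of two second
kind differentials on `E_τ`; only the poles contribute. -/
def poincarePairing (τ : UpperHalfPlane) (φ ψ : ℂ → ℂ) : ℂ :=
  ∑ᶠ p ∈ parallelogram τ, residue (fun z => localPrimitive φ p z * ψ z) p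

/-! ### `A`-cycle integrals -/

/-- `c : [0,1] → ℂ` lifts a closed piecewise differentiable curve on `E_τ` which represents the
`A`-cycle class (that is, the lift ends at its starting point plus the period `1`) and which does
not meet the poles of `φ`. -/
structure IsACycle (φ : ℂ → ℂ) (c : ℝ → ℂ) : Prop where
  continuousOn : ContinuousOn c (Set.Icc 0 1)
  differentiableAt : ∃ s : Set ℝ, s.Finite ∧ ∀ t ∈ Set.Ioo (0 : ℝ) 1 \ s, DifferentiableAt ℝ c t
  integrable : IntervalIntegrable (deriv c) MeasureTheory.volume 0 1
  closes : c 1 = c 0 + 1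
  avoids : ∀ t ∈ Set.Icc (0 : ℝ) 1, c t ∉ singularSet φ

/-- The integral of `φ dz` along `c : [0,1] → ℂ`. -/
def lineIntegral (φ : ℂ → ℂ) (c : ℝ → ℂ) : ℂ := ∫ t in (0 : ℝ)..1, φ (c t) * deriv c t

open Classical in
/-- The `A`-cycle integral `∫_A φ dz`, computed on some representative of the `A`-cycle class that
avoids the poles. -/
def aCycleIntegral (φ : ℂ → ℂ) : ℂ :=
  if h : ∃ c, IsACycle φ c then lineIntegral φ h.choose else 0

/-! ### Regularized integrals on `E_τ`

Forms on `E_τ` are written in the global frame `dz`, `dz̄`, with lattice periodic coefficients. -/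

/-- The Wirtinger derivative `∂_z = (∂_x - i ∂_y) / 2`. -/
def dZ (b : ℂ → ℂ) (z : ℂ) : ℂ :=
  (fderiv ℝ b z 1 - Complex.I * fderiv ℝ b z Complex.I) / 2

/-- `b` is smooth away from `D` with holomorphic poles of arbitrary order along `D`: near `p ∈ D` it
is a smooth function divided by a power of `z - p`. These are the coefficients of the forms in
`𝒜^{•,•}(E_τ, ⋆D)`. -/
def SmoothWithPoles (τ : UpperHalfPlane) (D : Set ℂ) (b : ℂ → ℂ) : Prop :=
  IsLatticePeriodic τ b ∧ (∀ p ∉ D, ContDiffAt ℝ ∞ b p) ∧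
  ∀ p ∈ D, ∃ (n : ℕ) (s : ℂ → ℂ), ContDiffAt ℝ ∞ s p ∧
    ∀ᶠ z in 𝓝[≠] p, b z = s z / (z - p) ^ n

/-- As `SmoothWithPoles`, with poles of order at most one. These are the coefficients of `dz ∧ dz̄`
of the forms in `𝒜²(E_τ, log D)`. -/
def SmoothWithLogPoles (τ : UpperHalfPlane) (D : Set ℂ) (a : ℂ → ℂ) : Prop :=
  IsLatticePeriodic τ a ∧ (∀ p ∉ D, ContDiffAt ℝ ∞ a p) ∧
  ∀ p ∈ D, ∃ s : ℂ → ℂ, ContDiffAt ℝ ∞ s p ∧ ∀ᶠ z in 𝓝[≠] p, a z = s z / (z - p)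

/-- The decomposition `ω = α + ∂β` on `E_τ - D`, where `ω = w dz ∧ dz̄`,
`α = a dz ∧ dz̄ ∈ 𝒜²(E_τ, log D)` and `β = b dz̄ ∈ 𝒜^{0,1}(E_τ, ⋆D)`. -/
structure IsDecomposition (τ : UpperHalfPlane) (D : Set ℂ) (w a b : ℂ → ℂ) : Prop where
  log : SmoothWithLogPoles τ D a
  poles : SmoothWithPoles τ D b
  eq : ∀ z ∉ D, w z = a z + dZ b z

/-- The integral over `E_τ` of the form `a dz ∧ dz̄ = -2i a dx ∧ dy`. -/
def torusIntegral (τ : UpperHalfPlane) (a : ℂ → ℂ) : ℂ :=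
  -2 * Complex.I * ∫ z in parallelogram τ, a z

open Classical in
/-- The regularized integral over `E_τ` of `ω = w dz ∧ dz̄` with poles along `D`: it is
`∫_{E_τ} α` for a decomposition `ω = α + ∂β`. -/
def regularizedIntegral (τ : UpperHalfPlane) (D : Set ℂ) (w : ℂ → ℂ) : ℂ :=
  if h : ∃ ab : (ℂ → ℂ) × (ℂ → ℂ), IsDecomposition τ D w ab.1 ab.2
  then torusIntegral τ h.choose.1 else 0

/-- The coefficient of `dz ∧ dz̄` in `(d²z / Im τ) φ`, where `d²z = (i/2) dz ∧ dz̄`. -/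
def normalizedForm (τ : UpperHalfPlane) (φ : ℂ → ℂ) (z : ℂ) : ℂ :=
  Complex.I / 2 / (τ.im : ℂ) * φ z

/-! ### Quasi-modularity and modular completion -/

/-- `f` is modular of weight `k` for `SL₂(ℤ)`. -/
def IsModular (k : ℤ) (f : UpperHalfPlane → ℂ) : Prop :=
  ∀ (γ : Matrix.SpecialLinearGroup (Fin 2) ℤ) (τ : UpperHalfPlane),
    f (γ • τ) = autFactor γ τ ^ k * f τ

/-- `f` is quasi-modular of weight `k` (and holomorphic on `ℍ`): there are finitely many holomorphic
functions `f₁, …, f_ℓ` with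
`f(γ τ) = (cτ+d)^k f(τ) + ∑_{i=1}^ℓ c^i (cτ+d)^(k-i) f_i(τ)` for all `γ ∈ SL₂(ℤ)`. -/
def IsQuasiModular (k : ℤ) (f : UpperHalfPlane → ℂ) : Prop :=
  MDifferentiable 𝓘(ℂ) 𝓘(ℂ) f ∧
  ∃ (ℓ : ℕ) (F : ℕ → UpperHalfPlane → ℂ), (∀ i, MDifferentiable 𝓘(ℂ) 𝓘(ℂ) (F i)) ∧
    ∀ (γ : Matrix.SpecialLinearGroup (Fin 2) ℤ) (τ : UpperHalfPlane),
      f (γ • τ) = autFactor γ τ ^ k * f τ +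
        ∑ i ∈ Finset.Icc 1 ℓ, ((γ 1 0 : ℤ) : ℂ) ^ i * autFactor γ τ ^ (k - (i : ℤ)) * F i τ

/-- `F ∈ 𝒪_ℍ[1 / Im τ]`, that is `F = ∑_{i=0}^N f_i / (Im τ)^i` with `f_i` holomorphic, and the
holomorphic limit `f_0` of `F` is `f`. -/
def HasHolomorphicLimit (F f : UpperHalfPlane → ℂ) : Prop :=
  ∃ (N : ℕ) (C : ℕ → UpperHalfPlane → ℂ), (∀ i, MDifferentiable 𝓘(ℂ) 𝓘(ℂ) (C i)) ∧ C 0 = f ∧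
    ∀ τ : UpperHalfPlane, F τ = ∑ i ∈ Finset.range (N + 1), C i τ / (τ.im : ℂ) ^ i

/-- `F` is the modular completion of the weight `k` quasi-modular function `f`: it is modular of
weight `k`, almost-holomorphic, and its holomorphic limit is `f`. -/
def IsModularCompletion (k : ℤ) (f F : UpperHalfPlane → ℂ) : Prop :=
  IsQuasiModular k f ∧ IsModular k F ∧ HasHolomorphicLimit F f

end RegInt

end

namespace RegInt

/-! ### Principal parts and residues -/

/-! Fix `τ`. Since `φ` has no residues, it has a single-valued meromorphic primitive `G` on all of
`ℂ` (`exists_primitive`). Its translates by lattice vectors are again primitives, so `G` is periodic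
up to constants, with periods `ω₁` along `1` and `ω₂` along `τ` (`exists_isPeriodicPrimitive`).
Every quantity in the theorem is a function of these two periods.

The `A`-cycle integral is `ω₁`, by the fundamental theorem of calculus. The residue theorem for `G`
on a period parallelogram gives the Legendre relation `2πi ⟨φ, dz⟩ = ω₁ τ - ω₂` (`legendre`). For
the regularized integral, let `A z + (ω₁ - A) z̄` be the real-linear function with the same periods
as `G`, so that `A = (ω₂ - ω₁ τ̄) / (τ - τ̄)`. Subtracting it from `G` leaves a periodic function
whose `∂_z` is `φ - A`. Hence the form splits with constant `α`, and the integral equals `A`.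
Another decomposition changes `β` by a function whose `∂_z` has at most simple poles; such a
function extends smoothly (`exists_smooth_of_dZ_simple_pole`), and Stokes' theorem shows that the
integral does not change.

As `τ` varies, the periods are holomorphic (`mdifferentiable_periods`), and rescaling `z` by `j = cτ
+ d` shows that `(ω₂, ω₁)` transforms by the matrix `γ` times `j ^ (k - 1)`
(`IsPeriodicPrimitive.smul`). Quasi-modularity of `ω₁`, modularity of `A` and the expansion `A = ω₁
+ (ω₂ - τ ω₁) / (2i Im τ)` are then linear algebra. -/

theorem exists_principalPart_div_pow (p : ℂ) (n : ℕ) : ∀ g : ℂ → ℂ, AnalyticAt ℂ g p →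
    ∃ (c : ℂ) (Q h : ℂ → ℂ), (∀ z, z ≠ p → AnalyticAt ℂ Q z) ∧ Meromorphic Q ∧
      AnalyticAt ℂ h p ∧
      ∀ᶠ z in 𝓝[≠] p, g z / (z - p) ^ n = c / (z - p) + deriv Q z + h z := by
  induction n with
  | zero =>
    intro g hg
    exact ⟨0, fun _ => 0, g, fun _ _ => analyticAt_const, Meromorphic.const 0, hg, by simp⟩
  | succ n ih =>
    intro g hg
    obtain ⟨g₁, hg₁, hgg₁⟩ : ∃ g₁ : ℂ → ℂ, AnalyticAt ℂ g₁ p ∧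
        ∀ z, g z = g p + (z - p) * g₁ z := by
      obtain ⟨P, hP⟩ := hg
      refine ⟨dslope g p, hP.has_fpower_series_dslope_fslope.analyticAt, fun z => ?_⟩
      have := sub_smul_dslope g p z
      simp only [smul_eq_mul] at this
      rw [this]; ring
    obtain ⟨c, Q, h, hQ, hQm, hh, he⟩ := ih g₁ hg₁
    -- The leading term `g p / (z - p) ^ (n + 1)` joins the simple pole when `n = 0`; otherwise it
    -- is the derivative of `R` below.
    rcases Nat.eq_zero_or_pos n with rfl | hn
    · refine ⟨c + g p, Q, h, hQ, hQm, hh, ?_⟩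
      filter_upwards [he, self_mem_nhdsWithin] with z hz hzp
      have hzp' : z - p ≠ 0 := sub_ne_zero.2 hzp
      have : g z / (z - p) ^ (0 + 1) = g p / (z - p) + g₁ z / (z - p) ^ 0 := by
        rw [hgg₁ z]; field_simp; ring
      rw [this, hz]; ring
    · have hn0 : (n : ℂ) ≠ 0 := by exact_mod_cast hn.ne'
      let R : ℂ → ℂ := fun z => -(g p / n) * ((z - p) ^ n)⁻¹
      have hR : ∀ z, z ≠ p → AnalyticAt ℂ R z := fun z hz => by
        have : (z - p) ^ n ≠ 0 := pow_ne_zero _ (sub_ne_zero.2 hz)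
        exact analyticAt_const.mul
          (((analyticAt_id.sub analyticAt_const).pow n).inv this)
      have hRm : Meromorphic R := fun z => by
        refine (MeromorphicAt.const _ _).mul (MeromorphicAt.inv (f := fun z => (z - p) ^ n) ?_)
        exact AnalyticAt.meromorphicAt ((analyticAt_id.sub analyticAt_const).pow n)
      have hRd : ∀ z, z ≠ p → deriv R z = g p / (z - p) ^ (n + 1) := fun z hz => by
        have hz' : z - p ≠ 0 := sub_ne_zero.2 hz
        have h1 : HasDerivAt (fun z : ℂ => (z - p) ^ n) (n * (z - p) ^ (n - 1) * 1) z :=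
          ((hasDerivAt_id z).sub_const p).pow n
        have h2 := (h1.inv (pow_ne_zero n hz')).const_mul (-(g p / n))
        refine h2.deriv.trans ?_
        obtain ⟨m, rfl⟩ : ∃ m, n = m + 1 := ⟨n - 1, by omega⟩
        simp only [Nat.add_sub_cancel] at *
        field_simp
        ring
      refine ⟨c, fun z => Q z + R z, h, fun z hz => (hQ z hz).add (hR z hz), hQm.add hRm, hh, ?_⟩
      filter_upwards [he, self_mem_nhdsWithin] with z hz hzp
      have hzp' : z - p ≠ 0 := sub_ne_zero.2 hzp
      have : g z / (z - p) ^ (n + 1) = g p / (z - p) ^ (n + 1) + g₁ z / (z - p) ^ n := by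
        rw [hgg₁ z]; field_simp; ring
      rw [this, hz, deriv_fun_add (hQ z hzp).differentiableAt (hR z hzp).differentiableAt,
        hRd z hzp]
      ring

/-- The principal part of a meromorphic function at a point: a simple pole plus a derivative. -/
theorem exists_principalPart {f : ℂ → ℂ} {p : ℂ} (hf : MeromorphicAt f p) :
    ∃ (c : ℂ) (Q h : ℂ → ℂ), (∀ z, z ≠ p → AnalyticAt ℂ Q z) ∧ Meromorphic Q ∧
      AnalyticAt ℂ h p ∧ ∀ᶠ z in 𝓝[≠] p, f z = c / (z - p) + deriv Q z + h z := by
  obtain ⟨n, hn⟩ := hf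
  obtain ⟨c, Q, h, hQ, hQm, hh, he⟩ := exists_principalPart_div_pow p n _ hn
  refine ⟨c, Q, h, hQ, hQm, hh, ?_⟩
  filter_upwards [he, self_mem_nhdsWithin] with z hz hzp
  have hzp' : z - p ≠ 0 := sub_ne_zero.2 hzp
  rw [← hz, smul_eq_mul]
  field_simp

theorem exists_primitive_of_analyticAt {h : ℂ → ℂ} {p : ℂ} (hh : AnalyticAt ℂ h p) :
    ∃ H : ℂ → ℂ, ∀ᶠ z in 𝓝 p, HasDerivAt H (h z) z := by
  obtain ⟨r, hr, hball⟩ := Metric.eventually_nhds_iff_ball.1 hh.eventually_analyticAt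
  obtain ⟨H, hH⟩ := DifferentiableOn.isExactOn_ball (f := h) (c := p) (r := r)
    (fun z hz => (hball z hz).differentiableAt.differentiableWithinAt)
  exact ⟨H, Filter.eventually_of_mem (Metric.ball_mem_nhds p hr) hH⟩

theorem analyticAt_of_eventually_hasDerivAt {H h : ℂ → ℂ} {p : ℂ}
    (hH : ∀ᶠ z in 𝓝 p, HasDerivAt H (h z) z) : AnalyticAt ℂ H p :=
  Complex.analyticAt_iff_eventually_differentiableAt.2 (hH.mono fun _ h => h.differentiableAt)

theorem eventually_nhdsNE_nhds {P : ℂ → Prop} {p : ℂ} (h : ∀ᶠ z in 𝓝[≠] p, P z) :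
    ∀ᶠ z in 𝓝[≠] p, ∀ᶠ w in 𝓝 z, P w := by
  have := eventually_eventually_nhdsWithin.2 h
  filter_upwards [this, self_mem_nhdsWithin] with z hz hzp
  rwa [IsOpen.nhdsWithin_eq isOpen_compl_singleton hzp] at hz

/-- Off a simple pole, a meromorphic function has a local meromorphic primitive. -/
theorem exists_local_primitive {f : ℂ → ℂ} {p : ℂ} (hf : MeromorphicAt f p) :
    ∃ (c : ℂ) (Q : ℂ → ℂ), MeromorphicAt Q p ∧
      ∀ᶠ z in 𝓝[≠] p, HasDerivAt Q (f z - c / (z - p)) z := by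
  obtain ⟨c, Q, h, hQ, hQm, hh, he⟩ := exists_principalPart hf
  obtain ⟨H, hH⟩ := exists_primitive_of_analyticAt hh
  refine ⟨c, fun z => Q z + H z,
    (hQm p).add (analyticAt_of_eventually_hasDerivAt hH).meromorphicAt, ?_⟩
  filter_upwards [he, hH.filter_mono nhdsWithin_le_nhds, self_mem_nhdsWithin] with z hz hHz hzp
  refine ((hQ z hzp).differentiableAt.hasDerivAt.fun_add hHz).congr_deriv ?_
  rw [hz]
  ring

/-- The residue is the coefficient of the simple pole. -/
theorem residue_eq {f Q : ℂ → ℂ} {p c : ℂ} (hf : MeromorphicAt f p)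
    (hQ : ∀ᶠ z in 𝓝[≠] p, HasDerivAt Q (f z - c / (z - p)) z) : residue f p = c := by
  -- Because `Q` is single-valued around `p`, the circle integral equals its limit on every
  -- sufficiently small circle.
  have hev : ∀ᶠ ε in 𝓝[>] (0 : ℝ),
      (2 * Real.pi * Complex.I)⁻¹ * (∮ z in C(p, ε), f z) = c := by
    have h0 := hQ.and hf.eventually_analyticAt
    rw [eventually_nhdsWithin_iff, Metric.eventually_nhds_iff] at h0
    obtain ⟨r, hr, hb⟩ := h0
    filter_upwards [Ioo_mem_nhdsGT hr] with ε hε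
    have hs : ∀ z ∈ Metric.sphere p ε, HasDerivAt Q (f z - c / (z - p)) z ∧ AnalyticAt ℂ f z := by
      intro z hz
      refine hb (by rw [Metric.mem_sphere.1 hz]; exact hε.2) ?_
      rintro rfl
      simp at hz
      exact hε.1.ne hz
    have hne : ∀ z ∈ Metric.sphere p ε, z - p ≠ 0 := by
      intro z hz h
      rw [Metric.mem_sphere, dist_eq_norm, h, norm_zero] at hz
      exact hε.1.ne hz
    have hfi : CircleIntegrable f p ε := ContinuousOn.circleIntegrable hε.1.le
      fun z hz => (hs z hz).2.continuousAt.continuousWithinAt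
    have hci : CircleIntegrable (fun z => c / (z - p)) p ε :=
      ContinuousOn.circleIntegrable hε.1.le
        (continuousOn_const.div (continuousOn_id.sub continuousOn_const) hne)
    have h1 := circleIntegral.integral_sub hfi hci
    rw [circleIntegral.integral_eq_zero_of_hasDerivWithinAt hε.1.le
      (fun z hz => (hs z hz).1.hasDerivWithinAt)] at h1
    have h2 : (∮ z in C(p, ε), c / (z - p)) = c * (2 * Real.pi * Complex.I) := by
      simp only [div_eq_mul_inv]
      rw [circleIntegral.integral_const_mul, circleIntegral.integral_sub_center_inv p hε.1.ne']
    rw [h2] at h1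
    rw [sub_eq_zero.1 h1.symm, mul_comm c, inv_mul_cancel_left₀ Complex.two_pi_I_ne_zero]
  exact Filter.Tendsto.limUnder_eq (tendsto_const_nhds.congr' (hev.mono fun _ h => h.symm))

theorem exists_local_primitive_residue {f : ℂ → ℂ} {p : ℂ} (hf : MeromorphicAt f p) :
    ∃ Q : ℂ → ℂ, MeromorphicAt Q p ∧
      ∀ᶠ z in 𝓝[≠] p, HasDerivAt Q (f z - residue f p / (z - p)) z := by
  obtain ⟨c, Q, hQm, hQ⟩ := exists_local_primitive hf
  exact ⟨Q, hQm, by rwa [residue_eq hf hQ]⟩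

theorem residue_congr {f g : ℂ → ℂ} {p : ℂ} (hf : MeromorphicAt f p) (h : f =ᶠ[𝓝[≠] p] g) :
    residue f p = residue g p := by
  obtain ⟨Q, -, hQ⟩ := exists_local_primitive_residue hf
  refine (residue_eq (hf.congr h) (Q := Q) ?_).symm
  filter_upwards [hQ, h] with z hz hzg
  rwa [← hzg]

theorem residue_add_analyticAt {f g : ℂ → ℂ} {p : ℂ} (hf : MeromorphicAt f p)
    (hg : AnalyticAt ℂ g p) : residue (fun z => f z + g z) p = residue f p := by
  obtain ⟨Q, -, hQ⟩ := exists_local_primitive_residue hf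
  obtain ⟨H, hH⟩ := exists_primitive_of_analyticAt hg
  refine residue_eq (hf.add hg.meromorphicAt) (Q := fun z => Q z + H z) ?_
  filter_upwards [hQ, hH.filter_mono nhdsWithin_le_nhds] with z hz hHz
  refine (hz.fun_add hHz).congr_deriv ?_
  ring

theorem residue_eq_zero_of_analyticAt {f : ℂ → ℂ} {p : ℂ} (hf : AnalyticAt ℂ f p) :
    residue f p = 0 := by
  obtain ⟨H, hH⟩ := exists_primitive_of_analyticAt hf
  refine residue_eq hf.meromorphicAt (Q := H) ?_
  simpa using hH.filter_mono nhdsWithin_le_nhds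

/-! ### Primitives on discs -/

/-- A disc is homeomorphic to the whole plane, where the complement of a countable set is connected.
-/
theorem ball_diff_countable_isPreconnected {S : Set ℂ} (hS : S.Countable) (c : ℂ) {r : ℝ}
    (hr : 0 < r) : IsPreconnected (Metric.ball c r \ S) := by
  let e := OpenPartialHomeomorph.univBall (E := ℂ) c r
  have hsrc : e.source = Set.univ := OpenPartialHomeomorph.univBall_source c r
  have htgt : e.target = Metric.ball c r := OpenPartialHomeomorph.univBall_target c hr
  have hinj : Function.Injective e := Set.injOn_univ.1 (hsrc ▸ e.injOn)
  have hcon : IsPreconnected (e ⁻¹' S)ᶜ :=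
    ((hS.preimage hinj).isConnected_compl_of_one_lt_rank (by simp)).isPreconnected
  have hcont : Continuous e := by
    rw [← continuousOn_univ, ← hsrc]; exact e.continuousOn
  have himg : e '' (e ⁻¹' S)ᶜ = Metric.ball c r \ S := by
    rw [← htgt, ← e.image_source_eq_target, hsrc]
    ext z
    constructor
    · rintro ⟨w, hw, rfl⟩; exact ⟨⟨w, trivial, rfl⟩, hw⟩
    · rintro ⟨⟨w, -, rfl⟩, hw⟩; exact ⟨w, hw, rfl⟩
  rw [← himg]
  exact hcon.image _ hcont.continuousOn

/-- Two primitives on a preconnected open set differ by a constant. -/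
theorem primitive_sub_eq {U : Set ℂ} (hU : IsOpen U) (hc : IsPreconnected U) {f G H : ℂ → ℂ}
    (hG : ∀ z ∈ U, HasDerivAt G (f z) z) (hH : ∀ z ∈ U, HasDerivAt H (f z) z) {a b : ℂ}
    (ha : a ∈ U) (hb : b ∈ U) : G a - H a = G b - H b := by
  refine hU.is_const_of_fderiv_eq_zero (𝕜 := ℂ) (f := fun z => G z - H z) hc ?_ ?_ ha hb
  · exact fun z hz => ((hG z hz).fun_sub (hH z hz)).differentiableAt.differentiableWithinAt
  · intro z hz
    have := ((hG z hz).fun_sub (hH z hz)).hasFDerivAt.fderiv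
    simpa using this

/-- Partial fractions on a disc: off finitely many simple poles, a meromorphic function has a
meromorphic primitive. -/
theorem exists_primitive_ball_finset (R : ℝ) (T : Finset ℂ) : ∀ f : ℂ → ℂ, Meromorphic f →
    (∀ z ∈ Metric.ball (0 : ℂ) R, z ∉ T → AnalyticAt ℂ f z) →
    ∃ (c : ℂ → ℂ) (Q : ℂ → ℂ), (∀ z ∈ Metric.ball (0 : ℂ) R, MeromorphicAt Q z) ∧
      ∀ z ∈ Metric.ball (0 : ℂ) R, z ∉ T →
        HasDerivAt Q (f z - ∑ p ∈ T, c p / (z - p)) z := by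
  classical
  induction T using Finset.induction_on with
  | empty =>
    intro f hf hfa
    obtain ⟨Q, hQ⟩ := DifferentiableOn.isExactOn_ball (f := f) (c := 0) (r := R)
      (fun z hz => (hfa z hz (by simp)).differentiableAt.differentiableWithinAt)
    refine ⟨0, Q, fun z hz => ?_, fun z hz _ => by simpa using hQ z hz⟩
    exact (analyticAt_of_eventually_hasDerivAt
      (Filter.eventually_of_mem (Metric.isOpen_ball.mem_nhds hz) hQ)).meromorphicAt
  | insert p T hpT ih =>
    intro f hf hfa
    obtain ⟨c, Q, h, hQ, hQm, hh, he⟩ := exists_principalPart (hf p)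
    let g : ℂ → ℂ := fun z => f z - c / (z - p) - deriv Q z
    have hgm : Meromorphic g := fun z => by
      refine ((hf z).sub ((MeromorphicAt.const _ _).div ?_)).sub ((hQm z).deriv)
      exact (analyticAt_id.sub analyticAt_const).meromorphicAt
    -- Subtracting the principal part leaves a removable singularity at `p`. The value at `p` is
    -- repaired so that the induction hypothesis applies with `p` no longer exceptional.
    let f' : ℂ → ℂ := Function.update g p (h p)
    have hf'm : Meromorphic f' := fun z => (hgm z).update _ _
    have hf'g : ∀ z, z ≠ p → f' z = g z := fun z hz => Function.update_of_ne hz _ _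
    have hf'a : ∀ z ∈ Metric.ball (0 : ℂ) R, z ∉ T → AnalyticAt ℂ f' z := by
      intro z hz hzT
      by_cases hzp : z = p
      · subst hzp
        refine hh.congr ?_
        rw [eventually_nhdsWithin_iff] at he
        filter_upwards [he] with w hw
        by_cases hwz : w = z
        · subst hwz; simp [f']
        · rw [hf'g w hwz]
          simp only [g]
          rw [hw hwz]; ring
      · have hga : AnalyticAt ℂ g z := by
          refine ((hfa z hz (by simp [hzp, hzT])).sub (analyticAt_const.div
            (analyticAt_id.sub analyticAt_const) (sub_ne_zero.2 hzp))).sub (hQ z hzp).deriv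
        refine hga.congr ?_
        filter_upwards [isOpen_ne.mem_nhds hzp] with w hw
        exact (hf'g w hw).symm
    obtain ⟨c', Q', hQ'm, hQ'⟩ := ih f' hf'm hf'a
    refine ⟨Function.update c' p c, fun z => Q z + Q' z, fun z hz => (hQm z).add (hQ'm z hz), ?_⟩
    intro z hz hzT
    simp only [Finset.mem_insert, not_or] at hzT
    refine ((hQ z hzT.1).differentiableAt.hasDerivAt.fun_add (hQ' z hz hzT.2)).congr_deriv ?_
    rw [Finset.sum_insert hpT, hf'g z hzT.1, Function.update_self]
    have : ∑ x ∈ T, Function.update c' p c x / (z - x) = ∑ x ∈ T, c' x / (z - x) :=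
      Finset.sum_congr rfl fun x hx => by
        rw [Function.update_of_ne (by rintro rfl; exact hpT hx)]
    rw [this]
    simp only [g]
    ring

/-- Near `p ∈ T` the fractions centred at the other points are holomorphic and have a local
primitive, so the coefficient at `p` can only be the residue. -/
theorem exists_primitive_ball (R : ℝ) (T : Finset ℂ) {f : ℂ → ℂ} (hf : Meromorphic f)
    (hT : ∀ p ∈ T, p ∈ Metric.ball (0 : ℂ) R)
    (hfa : ∀ z ∈ Metric.ball (0 : ℂ) R, z ∉ T → AnalyticAt ℂ f z) :
    ∃ Q : ℂ → ℂ, (∀ z ∈ Metric.ball (0 : ℂ) R, MeromorphicAt Q z) ∧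
      ∀ z ∈ Metric.ball (0 : ℂ) R, z ∉ T →
        HasDerivAt Q (f z - ∑ p ∈ T, residue f p / (z - p)) z := by
  classical
  obtain ⟨c, Q, hQm, hQ⟩ := exists_primitive_ball_finset R T f hf hfa
  refine ⟨Q, hQm, ?_⟩
  suffices h : ∀ p ∈ T, residue f p = c p by
    intro z hz hzT
    rw [Finset.sum_congr rfl fun p hp => by rw [h p hp]]
    exact hQ z hz hzT
  intro p hp
  have hga : AnalyticAt ℂ (fun z => ∑ q ∈ T.erase p, c q / (z - q)) p := by
    refine Finset.analyticAt_fun_sum _ fun q hq => ?_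
    exact analyticAt_const.div (analyticAt_id.sub analyticAt_const)
      (sub_ne_zero.2 (Finset.ne_of_mem_erase hq).symm)
  obtain ⟨H, hH⟩ := exists_primitive_of_analyticAt hga
  refine residue_eq (hf p) (Q := fun z => Q z + H z) ?_
  have hTp : ∀ᶠ z in 𝓝 p, z ∉ T.erase p :=
    (T.erase p).finite_toSet.isClosed.isOpen_compl.mem_nhds (by simp)
  filter_upwards [hH.filter_mono nhdsWithin_le_nhds, hTp.filter_mono nhdsWithin_le_nhds,
    self_mem_nhdsWithin,
    (Metric.isOpen_ball.eventually_mem (hT p hp)).filter_mono nhdsWithin_le_nhds]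
    with z hz hzT hzp hzb
  have hzT' : z ∉ T := fun h => hzT (Finset.mem_erase.2 ⟨hzp, h⟩)
  refine ((hQ z hzb hzT').fun_add hz).congr_deriv ?_
  rw [← Finset.add_sum_erase T _ hp]
  ring

/-! ### Singular sets -/

theorem isClosed_singularSet (f : ℂ → ℂ) : IsClosed (singularSet f) :=
  ⟨by
    have : (singularSet f)ᶜ = {z | AnalyticAt ℂ f z} := by ext z; simp [singularSet]
    rw [this]; exact isOpen_analyticAt ℂ f⟩

theorem eventually_notMem_singularSet {f : ℂ → ℂ} {p : ℂ} (hf : MeromorphicAt f p) :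
    ∀ᶠ z in 𝓝[≠] p, z ∉ singularSet f :=
  hf.eventually_analyticAt.mono fun _ h => not_not.2 h

/-- A set without accumulation points meets every compact set in a finite set. -/
theorem finite_inter_of_isolated {S K : Set ℂ} (hS : ∀ p, ∀ᶠ z in 𝓝[≠] p, z ∉ S)
    (hK : IsCompact K) : (S ∩ K).Finite := by
  by_contra h
  obtain ⟨p, -, hp⟩ := Set.Infinite.exists_accPt_of_subset_isCompact h hK Set.inter_subset_right
  rw [accPt_iff_frequently_nhdsNE] at hp
  exact hp ((hS p).mono fun z hz h => hz h.1)

theorem countable_of_isolated {S : Set ℂ} (hS : ∀ p, ∀ᶠ z in 𝓝[≠] p, z ∉ S) : S.Countable := by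
  have : S = ⋃ n : ℕ, S ∩ Metric.closedBall 0 n := by
    rw [← Set.inter_iUnion, Metric.iUnion_closedBall_nat, Set.inter_univ]
  rw [this]
  exact Set.countable_iUnion fun n =>
    (finite_inter_of_isolated hS (isCompact_closedBall 0 _)).countable

theorem countable_singularSet {f : ℂ → ℂ} (hf : Meromorphic f) : (singularSet f).Countable :=
  countable_of_isolated fun p => eventually_notMem_singularSet (hf p)

/-- Here `T` lists all singular points in the disc, including removable ones with a wrong value;
these have residue `0` and do no harm. -/
theorem exists_primitive_ball_residue {f : ℂ → ℂ} (hf : Meromorphic f) (R : ℝ) :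
    ∃ (T : Finset ℂ) (Q : ℂ → ℂ), (T : Set ℂ) = singularSet f ∩ Metric.ball 0 R ∧
      (∀ z ∈ Metric.ball (0 : ℂ) R, MeromorphicAt Q z) ∧
      ∀ z ∈ Metric.ball (0 : ℂ) R, z ∉ T →
        HasDerivAt Q (f z - ∑ p ∈ T, residue f p / (z - p)) z := by
  have hfin : (singularSet f ∩ Metric.ball 0 R).Finite :=
    (finite_inter_of_isolated (fun p => eventually_notMem_singularSet (hf p))
      (isCompact_closedBall 0 R)).subset
      (Set.inter_subset_inter_right _ Metric.ball_subset_closedBall)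
  refine ⟨hfin.toFinset, ?_⟩
  obtain ⟨Q, hQm, hQ⟩ := exists_primitive_ball R hfin.toFinset hf
    (fun p hp => ((Set.Finite.mem_toFinset _).1 hp).2) (fun z hz hzT => by
      by_contra h
      exact hzT ((Set.Finite.mem_toFinset _).2 ⟨h, hz⟩))
  exact ⟨Q, by simp, hQm, hQ⟩

/-- A meromorphic function on `ℂ` without residues has a meromorphic primitive. -/
theorem exists_primitive {f : ℂ → ℂ} (hf : Meromorphic f) (hres : IsSecondKind f) :
    ∃ G : ℂ → ℂ, Meromorphic G ∧ ∀ z ∉ singularSet f, HasDerivAt G (f z) z := by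
  have hS := countable_singularSet hf
  obtain ⟨z₀, hz₀, hz₀S⟩ : (Metric.ball (0 : ℂ) 1 ∩ (singularSet f)ᶜ).Nonempty :=
    (hS.dense_compl ℝ).inter_open_nonempty _ Metric.isOpen_ball ⟨0, by simp⟩
  have hz₀n : ∀ n : ℕ, z₀ ∈ Metric.ball (0 : ℂ) (n + 1) := fun n =>
    Metric.ball_subset_ball (by simp) hz₀
  choose T Q hT hQm hQ using fun n : ℕ => exists_primitive_ball_residue hf (n + 1)
  have hQ' : ∀ n : ℕ, ∀ z ∈ Metric.ball (0 : ℂ) (n + 1) \ singularSet f,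
      HasDerivAt (Q n) (f z) z := by
    intro n z hz
    have hzT : z ∉ T n := fun h => hz.2 ((hT n).subset h).1
    have := hQ n z hz.1 hzT
    simpa [hres _] using this
  have hcmp : ∀ n m : ℕ, n ≤ m → ∀ z ∈ Metric.ball (0 : ℂ) (n + 1) \ singularSet f,
      Q n z - Q m z = Q n z₀ - Q m z₀ := by
    intro n m hnm z hz
    have hsub : Metric.ball (0 : ℂ) (n + 1) ⊆ Metric.ball 0 (m + 1) :=
      Metric.ball_subset_ball (by gcongr)
    exact primitive_sub_eq (Metric.isOpen_ball.sdiff (isClosed_singularSet f))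
      (ball_diff_countable_isPreconnected hS 0 (by positivity)) (hQ' n)
      (fun w hw => hQ' m w ⟨hsub hw.1, hw.2⟩) hz ⟨hz₀n n, hz₀S⟩
  -- Glue the primitives on the discs of radius `n + 1`: use the smallest such disc containing `z`,
  -- and normalize at `z₀` so that primitives from different discs agree.
  let G : ℂ → ℂ := fun z => Q ⌊‖z‖⌋₊ z - Q ⌊‖z‖⌋₊ z₀
  have hG : ∀ n : ℕ, ∀ z ∈ Metric.ball (0 : ℂ) (n + 1) \ singularSet f,
      G z = Q n z - Q n z₀ := by
    intro n z hz
    have h1 : ⌊‖z‖⌋₊ ≤ n := by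
      have : ‖z‖ < n + 1 := by simpa using hz.1
      exact Nat.lt_succ_iff.1 ((Nat.floor_lt (norm_nonneg z)).2 (by exact_mod_cast this))
    have h2 : z ∈ Metric.ball (0 : ℂ) (⌊‖z‖⌋₊ + 1) := by
      simpa using Nat.lt_floor_add_one ‖z‖
    have := hcmp _ n h1 z ⟨h2, hz.2⟩
    simp only [G]
    linear_combination this
  have hmem : ∀ z : ℂ, z ∈ Metric.ball (0 : ℂ) (⌊‖z‖⌋₊ + 1) := fun z => by
    simpa using Nat.lt_floor_add_one ‖z‖
  refine ⟨G, fun z => ?_, fun z hz => ?_⟩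
  · have h1 : MeromorphicAt (fun w => Q ⌊‖z‖⌋₊ w - Q ⌊‖z‖⌋₊ z₀) z :=
      (hQm _ z (hmem z)).sub (MeromorphicAt.const _ _)
    refine h1.congr ?_
    filter_upwards [eventually_notMem_singularSet (hf z),
      (Metric.isOpen_ball.eventually_mem (hmem z)).filter_mono nhdsWithin_le_nhds] with w hw hwb
    exact (hG _ w ⟨hwb, hw⟩).symm
  · refine ((hQ' ⌊‖z‖⌋₊ z ⟨hmem z, hz⟩).sub_const (Q ⌊‖z‖⌋₊ z₀)).congr_of_eventuallyEq ?_
    filter_upwards [(isClosed_singularSet f).isOpen_compl.eventually_mem hz,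
      Metric.isOpen_ball.eventually_mem (hmem z)] with w hw hwb
    exact hG _ w ⟨hwb, hw⟩


/-! ### Periods of a meromorphic primitive -/

theorem IsLatticePeriodic.sub_eq {τ : UpperHalfPlane} {f : ℂ → ℂ} (hf : IsLatticePeriodic τ f)
    (m n : ℤ) (z : ℂ) : f (z - ((m : ℂ) + (n : ℂ) * (τ : ℂ))) = f z := by
  have := hf (-m) (-n) z
  push_cast at this
  rw [← this]; congr 1; ring

theorem IsLatticePeriodic.singularSet_iff {τ : UpperHalfPlane} {f : ℂ → ℂ}
    (hf : IsLatticePeriodic τ f) (m n : ℤ) (z : ℂ) :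
    z + ((m : ℂ) + (n : ℂ) * (τ : ℂ)) ∈ singularSet f ↔ z ∈ singularSet f := by
  have key : ∀ (m n : ℤ) (z : ℂ), AnalyticAt ℂ f z →
      AnalyticAt ℂ f (z + ((m : ℂ) + (n : ℂ) * (τ : ℂ))) := by
    intro m n z hz
    have h1 : AnalyticAt ℂ (fun w : ℂ => w - ((m : ℂ) + (n : ℂ) * (τ : ℂ)))
        (z + ((m : ℂ) + (n : ℂ) * (τ : ℂ))) := analyticAt_id.sub analyticAt_const
    refine (AnalyticAt.fun_comp (g := f) (by simpa using hz) h1).congr ?_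
    exact Filter.Eventually.of_forall fun w => hf.sub_eq m n w
  refine not_congr ⟨fun h => ?_, key m n z⟩
  have := key (-m) (-n) _ h
  push_cast at this
  convert this using 1
  ring

/-- `G` is a meromorphic primitive of `φ dz`, with periods `ω₁` along `1` and `ω₂` along `τ`. -/
structure IsPeriodicPrimitive (τ : UpperHalfPlane) (φ G : ℂ → ℂ) (ω₁ ω₂ : ℂ) : Prop where
  meromorphic : Meromorphic G
  hasDerivAt : ∀ z ∉ singularSet φ, HasDerivAt G (φ z) z
  add_period : ∀ (m n : ℤ), ∀ z ∉ singularSet φ,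
    G (z + ((m : ℂ) + (n : ℂ) * (τ : ℂ))) = G z + ((m : ℂ) * ω₁ + (n : ℂ) * ω₂)

theorem isPreconnected_compl_singularSet {φ : ℂ → ℂ} (hφ : Meromorphic φ) :
    IsPreconnected (singularSet φ)ᶜ :=
  ((countable_singularSet hφ).isConnected_compl_of_one_lt_rank (by simp)).isPreconnected

theorem exists_notMem_singularSet {φ : ℂ → ℂ} (hφ : Meromorphic φ) : ∃ z, z ∉ singularSet φ :=
  ((countable_singularSet hφ).dense_compl ℝ).nonempty

/-- The translate of `G` by a lattice vector is another primitive of `φ` on the connected complement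
of a countable set, so it differs from `G` by a constant. This constant is additive in the vector,
hence determined by its values on `1` and `τ`. -/
theorem exists_isPeriodicPrimitive {τ : UpperHalfPlane} {φ : ℂ → ℂ} (hφ : Meromorphic φ)
    (hper : IsLatticePeriodic τ φ) (hres : IsSecondKind φ) :
    ∃ G ω₁ ω₂, IsPeriodicPrimitive τ φ G ω₁ ω₂ := by
  obtain ⟨G, hGm, hG⟩ := exists_primitive hφ hres
  obtain ⟨z₀, hz₀⟩ := exists_notMem_singularSet hφ
  have hconst : ∀ (m n : ℤ), ∀ z ∉ singularSet φ,
      G (z + ((m : ℂ) + (n : ℂ) * (τ : ℂ))) =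
        G z + (G (z₀ + ((m : ℂ) + (n : ℂ) * (τ : ℂ))) - G z₀) := by
    intro m n z hz
    have h1 : ∀ w ∈ (singularSet φ)ᶜ,
        HasDerivAt (fun w => G (w + ((m : ℂ) + (n : ℂ) * (τ : ℂ)))) (φ w) w := by
      intro w hw
      have := hG _ (mt (hper.singularSet_iff m n w).1 hw)
      rw [hper m n w] at this
      exact this.comp_add_const _ _
    have := primitive_sub_eq (isClosed_singularSet φ).isOpen_compl
      (isPreconnected_compl_singularSet hφ) h1 hG hz hz₀
    linear_combination this
  let D : ℤ → ℤ → ℂ := fun m n => G (z₀ + ((m : ℂ) + (n : ℂ) * (τ : ℂ))) - G z₀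
  have hD : ∀ m n m' n', D (m + m') (n + n') = D m n + D m' n' := by
    intro m n m' n'
    have := hconst m' n' _ (mt (hper.singularSet_iff m n z₀).1 hz₀)
    simp only [D]
    push_cast
    have e : z₀ + ((m : ℂ) + m' + ((n : ℂ) + n') * (τ : ℂ)) =
      z₀ + ((m : ℂ) + (n : ℂ) * (τ : ℂ)) + ((m' : ℂ) + (n' : ℂ) * (τ : ℂ)) := by ring
    rw [e, this]; ring
  let F : ℤ × ℤ →+ ℂ := AddMonoidHom.mk' (fun x => D x.1 x.2) fun a b => hD _ _ _ _
  have hF : ∀ m n, D m n = m * D 1 0 + n * D 0 1 := by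
    intro m n
    have h1 : F (m, n) = F (m • (1, 0) + n • (0, 1)) := by simp
    rw [map_add, map_zsmul, map_zsmul, zsmul_eq_mul, zsmul_eq_mul] at h1
    exact h1
  refine ⟨G, D 1 0, D 0 1, hGm, hG, fun m n z hz => ?_⟩
  rw [← hF]
  exact hconst m n z hz

namespace IsPeriodicPrimitive

variable {τ : UpperHalfPlane} {φ G : ℂ → ℂ} {ω₁ ω₂ : ℂ}

theorem add_one (h : IsPeriodicPrimitive τ φ G ω₁ ω₂) {z : ℂ} (hz : z ∉ singularSet φ) :
    G (z + 1) = G z + ω₁ := by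
  simpa using h.add_period 1 0 z hz

theorem add_tau (h : IsPeriodicPrimitive τ φ G ω₁ ω₂) {z : ℂ} (hz : z ∉ singularSet φ) :
    G (z + τ) = G z + ω₂ := by
  simpa using h.add_period 0 1 z hz

/-- The periods do not depend on the primitive. -/
theorem unique (h : IsPeriodicPrimitive τ φ G ω₁ ω₂) (hφ : Meromorphic φ)
    (hper : IsLatticePeriodic τ φ) {G' : ℂ → ℂ} {ω₁' ω₂' : ℂ}
    (h' : IsPeriodicPrimitive τ φ G' ω₁' ω₂') : ω₁ = ω₁' ∧ ω₂ = ω₂' := by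
  obtain ⟨z₀, hz₀⟩ := exists_notMem_singularSet hφ
  have key : ∀ m n : ℤ, (m : ℂ) * ω₁ + n * ω₂ = m * ω₁' + n * ω₂' := fun m n => by
    have h1 := primitive_sub_eq (isClosed_singularSet φ).isOpen_compl
      (isPreconnected_compl_singularSet hφ) h.hasDerivAt h'.hasDerivAt
      (mt (hper.singularSet_iff m n z₀).1 hz₀) hz₀
    rw [h.add_period m n z₀ hz₀, h'.add_period m n z₀ hz₀] at h1
    linear_combination h1
  exact ⟨by simpa using key 1 0, by simpa using key 0 1⟩

/-- Along the curve, `G ∘ c` is continuous and has the integrand as derivative off a finite set, so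
the integral is the change of `G` from `c 0` to `c 0 + 1`. -/
theorem lineIntegral_eq (h : IsPeriodicPrimitive τ φ G ω₁ ω₂) {c : ℝ → ℂ} (hc : IsACycle φ c) :
    lineIntegral φ c = ω₁ := by
  obtain ⟨s, hs, hd⟩ := hc.differentiableAt
  have hG : ∀ t ∈ Set.Icc (0 : ℝ) 1, HasDerivAt G (φ (c t)) (c t) := fun t ht =>
    h.hasDerivAt _ (hc.avoids t ht)
  have huIcc : Set.uIcc (0 : ℝ) 1 = Set.Icc 0 1 := Set.uIcc_of_le zero_le_one
  have key := MeasureTheory.integral_eq_of_hasDerivAt_off_countable (fun t => G (c t))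
    (fun t => φ (c t) * deriv c t) (a := 0) (b := 1) hs.countable ?_ ?_ ?_
  · rw [lineIntegral, key, hc.closes, h.add_one (hc.avoids 0 (by simp))]
    ring
  · rw [huIcc]
    exact fun t ht => (hG t ht).continuousAt.comp_continuousWithinAt (hc.continuousOn t ht)
  · intro t ht
    simp only [zero_le_one, inf_of_le_left, sup_of_le_right] at ht
    exact (hG t (Set.Ioo_subset_Icc_self ht.1)).comp t (hd t ht).hasDerivAt
  · refine hc.integrable.continuousOn_mul ?_
    rw [huIcc]
    intro t ht
    have : AnalyticAt ℂ φ (c t) := not_not.1 (hc.avoids t ht)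
    exact this.continuousAt.comp_continuousWithinAt (hc.continuousOn t ht)

/-- The fundamental theorem of calculus on a segment without singularities. -/
theorem segment_integral (h : IsPeriodicPrimitive τ φ G ω₁ ω₂) (a l : ℂ)
    (ha : ∀ t ∈ Set.Icc (0 : ℝ) 1, a + t * l ∉ singularSet φ) :
    ∫ t in (0 : ℝ)..1, φ (a + t * l) * l = G (a + l) - G a := by
  have hd : ∀ t : ℝ, HasDerivAt (fun t : ℝ => a + t * l) l t := fun t => by
    simpa using ((Complex.ofRealCLM.hasDerivAt (x := t)).mul_const l).const_add a
  have huIcc : Set.uIcc (0 : ℝ) 1 = Set.Icc 0 1 := Set.uIcc_of_le zero_le_one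
  rw [intervalIntegral.integral_eq_sub_of_hasDerivAt (f := fun t : ℝ => G (a + t * l))]
  · simp
  · intro t ht
    rw [huIcc] at ht
    exact (h.hasDerivAt _ (ha t ht)).comp t (hd t)
  · refine ContinuousOn.intervalIntegrable ?_
    rw [huIcc]
    intro t ht
    have : AnalyticAt ℂ φ (a + t * l) := not_not.1 (ha t ht)
    exact (ContinuousAt.comp (f := fun t : ℝ => a + t * l) this.continuousAt
      (hd t).continuousAt).continuousWithinAt.mul continuousWithinAt_const

end IsPeriodicPrimitive

/-! ### Lattice coordinates -/

/-- The coordinate `y` of `z = x + y τ`. -/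
noncomputable def coordTau (τ : UpperHalfPlane) (z : ℂ) : ℝ := z.im / τ.im

/-- The coordinate `x` of `z = x + y τ`. -/
noncomputable def coordOne (τ : UpperHalfPlane) (z : ℂ) : ℝ := z.re - z.im / τ.im * τ.re

theorem coord_eq (τ : UpperHalfPlane) (z : ℂ) :
    (coordOne τ z : ℂ) + coordTau τ z * (τ : ℂ) = z := by
  have := τ.im_pos.ne'
  apply Complex.ext
  · simp [coordOne, coordTau]
  · simp [coordOne, coordTau, this]

theorem coordTau_add (τ : UpperHalfPlane) (x y : ℝ) : coordTau τ (x + y * (τ : ℂ)) = y := by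
  have := τ.im_pos.ne'
  simp [coordTau, this]

theorem coordOne_add (τ : UpperHalfPlane) (x y : ℝ) : coordOne τ (x + y * (τ : ℂ)) = x := by
  have := τ.im_pos.ne'
  simp [coordOne, this]

/-- Some lattice lines avoid a given countable set. -/
theorem exists_lines_avoiding (τ : UpperHalfPlane) {S : Set ℂ} (hS : S.Countable) :
    ∃ z₀ : ℂ, (∀ t : ℝ, z₀ + t ∉ S) ∧ (∀ t : ℝ, z₀ + t * (τ : ℂ) ∉ S) := by
  -- Each coordinate takes only countably many values on `S`. A line in direction `1` keeps the
  -- `τ`-coordinate `y`, and a line in direction `τ` keeps the coordinate `x`.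
  obtain ⟨x, hx⟩ := ((hS.image (coordOne τ)).dense_compl ℝ).nonempty
  obtain ⟨y, hy⟩ := ((hS.image (coordTau τ)).dense_compl ℝ).nonempty
  refine ⟨x + y * (τ : ℂ), fun t ht => hy ⟨_, ht, ?_⟩, fun t ht => hx ⟨_, ht, ?_⟩⟩
  · rw [show (x : ℂ) + y * (τ : ℂ) + t = ((x + t : ℝ) : ℂ) + y * (τ : ℂ) by push_cast; ring,
      coordTau_add]
  · rw [show (x : ℂ) + y * (τ : ℂ) + t * (τ : ℂ) = (x : ℂ) + ((y + t : ℝ) : ℂ) * (τ : ℂ) by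
      push_cast; ring, coordOne_add]

theorem isACycle_segment {φ : ℂ → ℂ} {z₀ : ℂ} (h : ∀ t : ℝ, z₀ + t ∉ singularSet φ) :
    IsACycle φ (fun t : ℝ => z₀ + t) := by
  have hd : ∀ t : ℝ, HasDerivAt (fun t : ℝ => z₀ + (t : ℂ)) 1 t := fun t => by
    simpa using (Complex.ofRealCLM.hasDerivAt (x := t)).const_add z₀
  refine ⟨fun t _ => (hd t).continuousAt.continuousWithinAt,
    ⟨∅, Set.finite_empty, fun t _ => (hd t).differentiableAt⟩, ?_, by simp, fun t _ => h t⟩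
  have : deriv (fun t : ℝ => z₀ + (t : ℂ)) = fun _ => 1 := funext fun t => (hd t).deriv
  rw [this]
  exact intervalIntegrable_const

theorem exists_isACycle (τ : UpperHalfPlane) {φ : ℂ → ℂ} (hφ : Meromorphic φ) :
    ∃ c, IsACycle φ c := by
  obtain ⟨z₀, h, -⟩ := exists_lines_avoiding τ (countable_singularSet hφ)
  exact ⟨_, isACycle_segment h⟩

theorem IsPeriodicPrimitive.aCycleIntegral_eq {τ : UpperHalfPlane} {φ G : ℂ → ℂ} {ω₁ ω₂ : ℂ}
    (h : IsPeriodicPrimitive τ φ G ω₁ ω₂) (hφ : Meromorphic φ) : aCycleIntegral φ = ω₁ := by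
  have hex := exists_isACycle τ hφ
  rw [aCycleIntegral, dif_pos hex]
  exact h.lineIntegral_eq hex.choose_spec


/-! ### The residue theorem on a lattice parallelogram -/

/-- The integral of `F dz` along the segment from `a` to `a + l`. -/
noncomputable def segmentIntegral (F : ℂ → ℂ) (a l : ℂ) : ℂ :=
  ∫ t in (0 : ℝ)..1, F (a + t * l) * l

/-- The integral of `F dz` along the boundary of the parallelogram with corner `z₀`. -/
noncomputable def boundaryIntegral (τ : UpperHalfPlane) (z₀ : ℂ) (F : ℂ → ℂ) : ℂ :=
  segmentIntegral F z₀ 1 + segmentIntegral F (z₀ + 1) τ - segmentIntegral F (z₀ + τ) 1 -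
    segmentIntegral F z₀ τ

/-- The boundary of the parallelogram with corner `z₀`. -/
def parallelogramEdge (τ : UpperHalfPlane) (z₀ : ℂ) : Set ℂ :=
  {z | ∃ s ∈ Set.Icc (0 : ℝ) 1, ∃ t ∈ Set.Icc (0 : ℝ) 1,
    (s = 0 ∨ s = 1 ∨ t = 0 ∨ t = 1) ∧ z = z₀ + (s + t * (τ : ℂ))}

theorem hasDerivAt_segment (a l : ℂ) (t : ℝ) : HasDerivAt (fun t : ℝ => a + t * l) l t := by
  simpa using ((Complex.ofRealCLM.hasDerivAt (x := t)).mul_const l).const_add a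

theorem uIcc_zero_one : Set.uIcc (0 : ℝ) 1 = Set.Icc 0 1 := Set.uIcc_of_le zero_le_one

theorem intervalIntegrable_segment {F : ℂ → ℂ} {a l : ℂ}
    (hF : ∀ t ∈ Set.Icc (0 : ℝ) 1, ContinuousAt F (a + t * l)) :
    IntervalIntegrable (fun t : ℝ => F (a + t * l) * l) MeasureTheory.volume 0 1 := by
  refine ContinuousOn.intervalIntegrable ?_
  rw [uIcc_zero_one]
  intro t ht
  exact (ContinuousAt.comp (f := fun t : ℝ => a + t * l) (hF t ht)
    (hasDerivAt_segment a l t).continuousAt).continuousWithinAt.mul continuousWithinAt_const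

theorem segmentIntegral_eq_sub {F H : ℂ → ℂ} {a l : ℂ}
    (hF : ∀ t ∈ Set.Icc (0 : ℝ) 1, ContinuousAt F (a + t * l))
    (hH : ∀ t ∈ Set.Icc (0 : ℝ) 1, HasDerivAt H (F (a + t * l)) (a + t * l)) :
    segmentIntegral F a l = H (a + l) - H a := by
  rw [segmentIntegral,
    intervalIntegral.integral_eq_sub_of_hasDerivAt (f := fun t : ℝ => H (a + t * l))]
  · simp
  · intro t ht
    rw [uIcc_zero_one] at ht
    exact (hH t ht).comp t (hasDerivAt_segment a l t)
  · exact intervalIntegrable_segment hF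

theorem segment_mem_edge (τ : UpperHalfPlane) (z₀ : ℂ) {t : ℝ} (ht : t ∈ Set.Icc (0 : ℝ) 1) :
    z₀ + t * 1 ∈ parallelogramEdge τ z₀ ∧ z₀ + 1 + t * τ ∈ parallelogramEdge τ z₀ ∧
    z₀ + τ + t * 1 ∈ parallelogramEdge τ z₀ ∧ z₀ + t * τ ∈ parallelogramEdge τ z₀ := by
  refine ⟨⟨t, ht, 0, by simp, by simp, by simp⟩,
    ⟨1, by simp, t, ht, by simp, by push_cast; ring⟩,
    ⟨t, ht, 1, by simp, by simp, by push_cast; ring⟩, ⟨0, by simp, t, ht, by simp, by simp⟩⟩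

theorem boundaryIntegral_eq_zero {τ : UpperHalfPlane} {z₀ : ℂ} {F H : ℂ → ℂ}
    (hF : ∀ z ∈ parallelogramEdge τ z₀, ContinuousAt F z)
    (hH : ∀ z ∈ parallelogramEdge τ z₀, HasDerivAt H (F z) z) :
    boundaryIntegral τ z₀ F = 0 := by
  have h := fun t ht => segment_mem_edge τ z₀ (t := t) ht
  rw [boundaryIntegral,
    segmentIntegral_eq_sub (fun t ht => hF _ (h t ht).1) (fun t ht => hH _ (h t ht).1),
    segmentIntegral_eq_sub (fun t ht => hF _ (h t ht).2.1) (fun t ht => hH _ (h t ht).2.1),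
    segmentIntegral_eq_sub (fun t ht => hF _ (h t ht).2.2.1) (fun t ht => hH _ (h t ht).2.2.1),
    segmentIntegral_eq_sub (fun t ht => hF _ (h t ht).2.2.2) (fun t ht => hH _ (h t ht).2.2.2)]
  rw [show z₀ + 1 + (τ : ℂ) = z₀ + τ + 1 by ring]
  ring

theorem segmentIntegral_add {F F' : ℂ → ℂ} {a l : ℂ}
    (hF : ∀ t ∈ Set.Icc (0 : ℝ) 1, ContinuousAt F (a + t * l))
    (hF' : ∀ t ∈ Set.Icc (0 : ℝ) 1, ContinuousAt F' (a + t * l)) :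
    segmentIntegral (fun z => F z + F' z) a l =
      segmentIntegral F a l + segmentIntegral F' a l := by
  rw [segmentIntegral, segmentIntegral, segmentIntegral,
    ← intervalIntegral.integral_add (intervalIntegrable_segment hF)
    (intervalIntegrable_segment hF')]
  simp only [add_mul]

theorem boundaryIntegral_add {τ : UpperHalfPlane} {z₀ : ℂ} {F F' : ℂ → ℂ}
    (hF : ∀ z ∈ parallelogramEdge τ z₀, ContinuousAt F z)
    (hF' : ∀ z ∈ parallelogramEdge τ z₀, ContinuousAt F' z) :
    boundaryIntegral τ z₀ (fun z => F z + F' z) =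
      boundaryIntegral τ z₀ F + boundaryIntegral τ z₀ F' := by
  have h := fun t ht => segment_mem_edge τ z₀ (t := t) ht
  simp only [boundaryIntegral]
  rw [segmentIntegral_add (fun t ht => hF _ (h t ht).1) (fun t ht => hF' _ (h t ht).1),
    segmentIntegral_add (fun t ht => hF _ (h t ht).2.1) (fun t ht => hF' _ (h t ht).2.1),
    segmentIntegral_add (fun t ht => hF _ (h t ht).2.2.1) (fun t ht => hF' _ (h t ht).2.2.1),
    segmentIntegral_add (fun t ht => hF _ (h t ht).2.2.2) (fun t ht => hF' _ (h t ht).2.2.2)]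
  ring

theorem boundaryIntegral_const_mul (τ : UpperHalfPlane) (z₀ c : ℂ) (F : ℂ → ℂ) :
    boundaryIntegral τ z₀ (fun z => c * F z) = c * boundaryIntegral τ z₀ F := by
  simp only [boundaryIntegral, segmentIntegral, mul_assoc, intervalIntegral.integral_const_mul]
  ring

theorem boundaryIntegral_sum {τ : UpperHalfPlane} {z₀ : ℂ} (T : Finset ℂ) {F : ℂ → ℂ → ℂ}
    (hF : ∀ p ∈ T, ∀ z ∈ parallelogramEdge τ z₀, ContinuousAt (F p) z) :
    boundaryIntegral τ z₀ (fun z => ∑ p ∈ T, F p z) = ∑ p ∈ T, boundaryIntegral τ z₀ (F p) := by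
  classical
  induction T using Finset.induction_on with
  | empty => simp [boundaryIntegral, segmentIntegral]
  | insert p T hp ih =>
    simp only [Finset.sum_insert hp]
    rw [boundaryIntegral_add (hF p (Finset.mem_insert_self _ _)), ih]
    · exact fun q hq => hF q (Finset.mem_insert_of_mem hq)
    · intro z hz
      exact tendsto_finsetSum T fun q hq => hF q (Finset.mem_insert_of_mem hq) z hz

theorem im_div_pos {a b : ℂ} (h : 0 < (b * (starRingEnd ℂ) a).im) : 0 < (b / a).im := by
  have ha : a ≠ 0 := by rintro rfl; simp at h
  rw [div_eq_mul_inv, Complex.inv_def, ← mul_assoc, Complex.im_mul_ofReal]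
  exact mul_pos h (inv_pos.2 (Complex.normSq_pos.2 ha))

/-- The integral of `dz / (z - p)` along a segment which is seen from `p` under an angle in
`(-π, π)`. -/
theorem segmentIntegral_inv {a l p : ℂ} (h : ((a + l - p) / (a - p)).im ≠ 0) :
    segmentIntegral (fun z => (z - p)⁻¹) a l = Complex.log ((a + l - p) / (a - p)) := by
  have ha : a - p ≠ 0 := by intro h0; simp [h0] at h
  have him : (l / (a - p)).im ≠ 0 := by
    have : (a + l - p) / (a - p) = 1 + l / (a - p) := by field_simp; ring
    rw [this] at h
    simpa using h
  -- Divided by its initial value, `z - p` runs along `1 + t w` with `w` not real. It therefore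
  -- leaves the real axis immediately, and the principal logarithm is a primitive along the whole
  -- segment.
  have hslit : ∀ t : ℝ, (a + t * l - p) / (a - p) ∈ Complex.slitPlane := by
    intro t
    have e : (a + t * l - p) / (a - p) = 1 + t * (l / (a - p)) := by field_simp; ring
    rw [e, Complex.mem_slitPlane_iff]
    rcases eq_or_ne t 0 with rfl | ht
    · left; simp
    · right; simp [ht, him]
  have hne : ∀ t : ℝ, a + t * l - p ≠ 0 := fun t h0 => by
    have := Complex.slitPlane_ne_zero (hslit t)
    simp [h0] at this
  rw [segmentIntegral_eq_sub (H := fun z => Complex.log ((z - p) / (a - p)))]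
  · simp [ha]
  · exact fun t _ => (continuousAt_id.sub continuousAt_const).inv₀ (hne t)
  · intro t _
    have h1 : HasDerivAt (fun z : ℂ => (z - p) / (a - p)) (1 / (a - p)) (a + t * l) :=
      ((hasDerivAt_id _).sub_const p).div_const _
    refine (h1.clog (hslit t)).congr_deriv ?_
    have := hne t
    field_simp

/-- The sum is an integral multiple of `2πi`, while its imaginary part is a sum of four arguments in
`(0, π)` and so lies in `(0, 4π)`. Only `2πi` remains. -/
theorem sum_log_eq_two_pi_I {w₁ w₂ w₃ w₄ : ℂ} (h₁ : 0 < w₁.im) (h₂ : 0 < w₂.im)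
    (h₃ : 0 < w₃.im) (h₄ : 0 < w₄.im) (h : w₁ * w₂ * w₃ * w₄ = 1) :
    Complex.log w₁ + Complex.log w₂ + Complex.log w₃ + Complex.log w₄ =
      2 * Real.pi * Complex.I := by
  have hne : ∀ w : ℂ, 0 < w.im → w ≠ 0 := by rintro w hw rfl; simp at hw
  have harg : ∀ w : ℂ, 0 < w.im → 0 < w.arg ∧ w.arg < Real.pi := fun w hw => by
    refine ⟨lt_of_le_of_ne (Complex.arg_nonneg_iff.2 hw.le) fun h0 => ?_,
      Complex.arg_lt_pi_iff.2 (Or.inr hw.ne')⟩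
    exact hw.ne' (Complex.arg_eq_zero_iff.1 h0.symm).2
  have hexp : Complex.exp (Complex.log w₁ + Complex.log w₂ + Complex.log w₃ + Complex.log w₄)
      = 1 := by
    rw [Complex.exp_add, Complex.exp_add, Complex.exp_add, Complex.exp_log (hne _ h₁),
      Complex.exp_log (hne _ h₂), Complex.exp_log (hne _ h₃), Complex.exp_log (hne _ h₄), h]
  obtain ⟨n, hn⟩ := Complex.exp_eq_one_iff.1 hexp
  have him := congrArg Complex.im hn
  simp only [Complex.add_im, Complex.log_im] at him
  have e : ((n : ℂ) * (2 * Real.pi * Complex.I)).im = n * (2 * Real.pi) := by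
    rw [show (n : ℂ) * (2 * Real.pi * Complex.I) = ((n * (2 * Real.pi) : ℝ) : ℂ) * Complex.I by
      push_cast; ring]
    simp
  rw [e] at him
  have hpi := Real.pi_pos
  obtain ⟨a1, b1⟩ := harg _ h₁
  obtain ⟨a2, b2⟩ := harg _ h₂
  obtain ⟨a3, b3⟩ := harg _ h₃
  obtain ⟨a4, b4⟩ := harg _ h₄
  have hn1 : (0 : ℝ) < n := by
    by_contra! hc
    nlinarith
  have hn2 : (n : ℝ) < 2 := by
    by_contra! hc
    nlinarith
  have hn3 : n = 1 := by
    have h1 : 0 < n := by exact_mod_cast hn1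
    have h2 : n < 2 := by exact_mod_cast hn2
    omega
  rw [hn, hn3]; simp

theorem coord_sub_mul_conj_im (τ : UpperHalfPlane) (s t s' t' : ℝ) :
    (((s' : ℂ) + t' * (τ : ℂ)) * (starRingEnd ℂ) ((s : ℂ) + t * (τ : ℂ))).im =
      τ.im * (s * t' - s' * t) := by
  simp [Complex.mul_im]
  ring

/-- From an interior point each edge, traversed counterclockwise, is seen under an angle in `(0,
π)`; the four quotients of consecutive corners multiply to `1`. -/
theorem boundaryIntegral_inv_of_mem {τ : UpperHalfPlane} {z₀ p : ℂ}
    (hx : coordOne τ (p - z₀) ∈ Set.Ioo (0 : ℝ) 1) (hy : coordTau τ (p - z₀) ∈ Set.Ioo (0 : ℝ) 1) :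
    boundaryIntegral τ z₀ (fun z => (z - p)⁻¹) = 2 * Real.pi * Complex.I := by
  set x := coordOne τ (p - z₀)
  set y := coordTau τ (p - z₀)
  have hp : p = z₀ + (x + y * (τ : ℂ)) := by rw [coord_eq]; ring
  have hτ := τ.im_pos
  have key : ∀ s t s' t' : ℝ, 0 < s * t' - s' * t →
      0 < (((s' : ℂ) + t' * (τ : ℂ)) / ((s : ℂ) + t * (τ : ℂ))).im := fun s t s' t' h =>
    im_div_pos (by rw [coord_sub_mul_conj_im]; exact mul_pos hτ h)
  have e1 : z₀ - p = ((-x : ℝ) : ℂ) + ((-y : ℝ) : ℂ) * τ := by rw [hp]; push_cast; ring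
  have e2 : z₀ + 1 - p = ((1 - x : ℝ) : ℂ) + ((-y : ℝ) : ℂ) * τ := by rw [hp]; push_cast; ring
  have e3 : z₀ + 1 + τ - p = ((1 - x : ℝ) : ℂ) + ((1 - y : ℝ) : ℂ) * τ := by
    rw [hp]; push_cast; ring
  have e3' : z₀ + τ + 1 - p = ((1 - x : ℝ) : ℂ) + ((1 - y : ℝ) : ℂ) * τ := by
    rw [hp]; push_cast; ring
  have e4 : z₀ + τ - p = ((-x : ℝ) : ℂ) + ((1 - y : ℝ) : ℂ) * τ := by rw [hp]; push_cast; ring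
  -- The four determinants are `y`, `1 - x`, `1 - y` and `x`, the distances to the edges in lattice
  -- coordinates.
  have i1 := key (-x) (-y) (1 - x) (-y) (by nlinarith [hx.1, hx.2, hy.1, hy.2])
  have i2 := key (1 - x) (-y) (1 - x) (1 - y) (by nlinarith [hx.1, hx.2, hy.1, hy.2])
  have i3 := key (1 - x) (1 - y) (-x) (1 - y) (by nlinarith [hx.1, hx.2, hy.1, hy.2])
  have i4 := key (-x) (1 - y) (-x) (-y) (by nlinarith [hx.1, hx.2, hy.1, hy.2])
  rw [← e1, ← e2] at i1
  rw [← e2, ← e3] at i2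
  rw [← e3', ← e4] at i3
  rw [← e4, ← e1] at i4
  have inv_im : ∀ w : ℂ, 0 < w.im → (w⁻¹).im ≠ 0 := fun w hw => by
    have hw0 : w ≠ 0 := by rintro rfl; simp at hw
    rw [Complex.inv_im]
    exact div_ne_zero (by simpa using hw.ne') (Complex.normSq_pos.2 hw0).ne'
  -- The top and left edges enter `boundaryIntegral` with reversed direction and a minus sign, so
  -- their quotients appear inverted.
  have log_inv' : ∀ w : ℂ, 0 < w.im → Complex.log w⁻¹ = - Complex.log w := fun w hw =>
    Complex.log_inv _ (Complex.arg_lt_pi_iff.2 (Or.inr hw.ne')).ne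
  have i3' := inv_im _ i3
  have i4' := inv_im _ i4
  have l3 := log_inv' _ i3
  have l4 := log_inv' _ i4
  rw [inv_div] at i3' i4' l3 l4
  rw [boundaryIntegral, segmentIntegral_inv i1.ne', segmentIntegral_inv i2.ne',
    segmentIntegral_inv i3', segmentIntegral_inv i4', l3, l4, sub_neg_eq_add, sub_neg_eq_add]
  refine sum_log_eq_two_pi_I i1 i2 i3 i4 ?_
  have nz : ∀ a b : ℂ, 0 < (a / b).im → b ≠ 0 := by rintro a b h rfl; simp at h
  have n1 := nz _ _ i1
  have n2 := nz _ _ i2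
  have n3 := nz _ _ i3
  have n4 := nz _ _ i4
  rw [show z₀ + 1 + (τ : ℂ) = z₀ + τ + 1 by ring]
  field_simp

/-- When the boundary lies in an open half-plane bounded by a line through `p`, the rotated
logarithm `log (m (z - p))` is a single-valued primitive all along it. -/
theorem boundaryIntegral_inv_of_halfPlane {τ : UpperHalfPlane} {z₀ p m : ℂ}
    (h : ∀ z ∈ parallelogramEdge τ z₀, 0 < (m * (z - p)).re) :
    boundaryIntegral τ z₀ (fun z => (z - p)⁻¹) = 0 := by
  have hne : ∀ z ∈ parallelogramEdge τ z₀, m * (z - p) ≠ 0 := fun z hz h0 => by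
    have := h z hz
    simp [h0] at this
  refine boundaryIntegral_eq_zero (H := fun z => Complex.log (m * (z - p)))
    (fun z hz => ?_) fun z hz => ?_
  · exact (continuousAt_id.sub continuousAt_const).inv₀ (right_ne_zero_of_mul (hne z hz))
  · have h1 : HasDerivAt (fun z : ℂ => m * (z - p)) (m * 1) z :=
      ((hasDerivAt_id _).sub_const p).const_mul m
    refine (h1.clog (Complex.mem_slitPlane_iff.2 (Or.inl (h z hz)))).congr_deriv ?_
    have h2 := left_ne_zero_of_mul (hne z hz)
    have h3 := right_ne_zero_of_mul (hne z hz)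
    field_simp

/-- A point outside the closed parallelogram is strictly separated from it by a line parallel to one
of the sides; `m` is a normal to that line. -/
theorem boundaryIntegral_inv_of_notMem {τ : UpperHalfPlane} {z₀ p : ℂ}
    (h : coordOne τ (p - z₀) ∉ Set.Icc (0 : ℝ) 1 ∨ coordTau τ (p - z₀) ∉ Set.Icc (0 : ℝ) 1) :
    boundaryIntegral τ z₀ (fun z => (z - p)⁻¹) = 0 := by
  set x := coordOne τ (p - z₀)
  set y := coordTau τ (p - z₀)
  have hp : p = z₀ + (x + y * (τ : ℂ)) := by rw [coord_eq]; ring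
  have hτ := τ.im_pos
  have hz : ∀ s t : ℝ, z₀ + (s + t * (τ : ℂ)) - p = ((s - x : ℝ) : ℂ) + ((t - y : ℝ) : ℂ) * τ := by
    intro s t; rw [hp]; push_cast; ring
  -- Multiplication by `i τ̄`, respectively `-i`, turns the lattice coordinate `s`, respectively
  -- `t`, into a real part, up to the factor `Im τ`.
  have hc : ∀ s t : ℝ, (Complex.I * (starRingEnd ℂ) (τ : ℂ) * ((s : ℂ) + t * τ)).re =
      s * τ.im := by
    intro s t
    simp [Complex.mul_re, Complex.mul_im]
    ring
  have hd : ∀ s t : ℝ, (-Complex.I * ((s : ℂ) + t * τ)).re = t * τ.im := by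
    intro s t
    simp [Complex.mul_re, Complex.mul_im]
  simp only [Set.mem_Icc, not_and_or, not_le] at h
  rcases h with (h | h) | (h | h)
  · refine boundaryIntegral_inv_of_halfPlane (m := Complex.I * (starRingEnd ℂ) (τ : ℂ)) ?_
    rintro z ⟨s, hs, t, ht, -, rfl⟩
    rw [hz, hc]
    exact mul_pos (by linarith [hs.1]) hτ
  · refine boundaryIntegral_inv_of_halfPlane (m := -(Complex.I * (starRingEnd ℂ) (τ : ℂ))) ?_
    rintro z ⟨s, hs, t, ht, -, rfl⟩
    rw [hz, neg_mul, Complex.neg_re, hc, ← neg_mul]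
    exact mul_pos (by linarith [hs.2]) hτ
  · refine boundaryIntegral_inv_of_halfPlane (m := -Complex.I) ?_
    rintro z ⟨s, hs, t, ht, -, rfl⟩
    rw [hz, hd]
    exact mul_pos (by linarith [ht.1]) hτ
  · refine boundaryIntegral_inv_of_halfPlane (m := Complex.I) ?_
    rintro z ⟨s, hs, t, ht, -, rfl⟩
    rw [hz, ← neg_neg Complex.I, neg_mul, Complex.neg_re, hd, ← neg_mul]
    exact mul_pos (by linarith [ht.2]) hτ

/-- The half-open parallelogram with corner `z₀`. -/
def shiftedParallelogram (τ : UpperHalfPlane) (z₀ : ℂ) : Set ℂ :=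
  {z | coordOne τ (z - z₀) ∈ Set.Ico (0 : ℝ) 1 ∧ coordTau τ (z - z₀) ∈ Set.Ico (0 : ℝ) 1}

theorem mem_edge_of_coord {τ : UpperHalfPlane} {z₀ p : ℂ}
    (hx : coordOne τ (p - z₀) ∈ Set.Icc (0 : ℝ) 1) (hy : coordTau τ (p - z₀) ∈ Set.Icc (0 : ℝ) 1)
    (h : coordOne τ (p - z₀) = 0 ∨ coordOne τ (p - z₀) = 1 ∨ coordTau τ (p - z₀) = 0 ∨
      coordTau τ (p - z₀) = 1) : p ∈ parallelogramEdge τ z₀ :=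
  ⟨_, hx, _, hy, h, by rw [coord_eq]; ring⟩

open Classical in
theorem boundaryIntegral_inv {τ : UpperHalfPlane} {z₀ p : ℂ} (hp : p ∉ parallelogramEdge τ z₀) :
    boundaryIntegral τ z₀ (fun z => (z - p)⁻¹) =
      if p ∈ shiftedParallelogram τ z₀ then 2 * Real.pi * Complex.I else 0 := by
  by_cases hx : coordOne τ (p - z₀) ∈ Set.Icc (0 : ℝ) 1
  · by_cases hy : coordTau τ (p - z₀) ∈ Set.Icc (0 : ℝ) 1
    · have h := mt (mem_edge_of_coord hx hy) hp
      simp only [not_or] at h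
      obtain ⟨h1, h2, h3, h4⟩ := h
      have hx' : coordOne τ (p - z₀) ∈ Set.Ioo (0 : ℝ) 1 :=
        ⟨lt_of_le_of_ne hx.1 (Ne.symm h1), lt_of_le_of_ne hx.2 h2⟩
      have hy' : coordTau τ (p - z₀) ∈ Set.Ioo (0 : ℝ) 1 :=
        ⟨lt_of_le_of_ne hy.1 (Ne.symm h3), lt_of_le_of_ne hy.2 h4⟩
      rw [boundaryIntegral_inv_of_mem hx' hy', if_pos]
      exact ⟨Set.Ioo_subset_Ico_self hx', Set.Ioo_subset_Ico_self hy'⟩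
    · rw [boundaryIntegral_inv_of_notMem (Or.inr hy), if_neg]
      exact fun h => hy (Set.Ico_subset_Icc_self h.2)
  · rw [boundaryIntegral_inv_of_notMem (Or.inl hx), if_neg]
    exact fun h => hx (Set.Ico_subset_Icc_self h.1)

theorem add_coord_mem_ball (τ : UpperHalfPlane) (z₀ : ℂ) {s t : ℝ}
    (hs : s ∈ Set.Icc (0 : ℝ) 1) (ht : t ∈ Set.Icc (0 : ℝ) 1) :
    z₀ + (s + t * (τ : ℂ)) ∈ Metric.ball (0 : ℂ) (‖z₀‖ + 1 + ‖(τ : ℂ)‖ + 1) := by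
  have h1 : ‖(s : ℂ)‖ ≤ 1 := by
    rw [Complex.norm_real, Real.norm_of_nonneg hs.1]; exact hs.2
  have h2 : ‖(t : ℂ)‖ ≤ 1 := by
    rw [Complex.norm_real, Real.norm_of_nonneg ht.1]; exact ht.2
  rw [mem_ball_zero_iff]
  calc ‖z₀ + (s + t * (τ : ℂ))‖ ≤ ‖z₀‖ + (‖(s : ℂ)‖ + ‖(t : ℂ)‖ * ‖(τ : ℂ)‖) := by
        refine (norm_add_le _ _).trans ?_
        gcongr
        refine (norm_add_le _ _).trans ?_
        rw [norm_mul]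
    _ ≤ ‖z₀‖ + (1 + 1 * ‖(τ : ℂ)‖) := by gcongr
    _ < _ := by linarith

/-- The residue theorem on a lattice parallelogram. -/
theorem boundaryIntegral_eq_sum_residue {τ : UpperHalfPlane} {z₀ : ℂ} {f : ℂ → ℂ}
    (hf : Meromorphic f) (hedge : ∀ z ∈ parallelogramEdge τ z₀, z ∉ singularSet f) :
    boundaryIntegral τ z₀ f =
      2 * Real.pi * Complex.I * ∑ᶠ p ∈ shiftedParallelogram τ z₀, residue f p := by
  classical
  -- The disc contains the closed parallelogram. It may contain further singular points, whose
  -- fractions integrate to `0` along the boundary.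
  obtain ⟨T, Q, hT, -, hQ⟩ := exists_primitive_ball_residue hf (‖z₀‖ + 1 + ‖(τ : ℂ)‖ + 1)
  have hTs : ∀ p ∈ T, p ∈ singularSet f := fun p hp => (hT.subset hp).1
  have hTe : ∀ z ∈ parallelogramEdge τ z₀, ∀ p ∈ T, z - p ≠ 0 := by
    intro z hz p hp h0
    rw [sub_eq_zero] at h0
    exact hedge z hz (h0 ▸ hTs p hp)
  have hci : ∀ p ∈ T, ∀ z ∈ parallelogramEdge τ z₀,
      ContinuousAt (fun z => residue f p * (z - p)⁻¹) z := fun p hp z hz =>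
    continuousAt_const.mul ((continuousAt_id.sub continuousAt_const).inv₀ (hTe z hz p hp))
  have hcs : ∀ z ∈ parallelogramEdge τ z₀,
      ContinuousAt (fun z => ∑ p ∈ T, residue f p * (z - p)⁻¹) z := fun z hz =>
    tendsto_finsetSum T fun p hp => hci p hp z hz
  have hcf : ∀ z ∈ parallelogramEdge τ z₀, ContinuousAt f z := fun z hz =>
    (not_not.1 (hedge z hz) : AnalyticAt ℂ f z).continuousAt
  have hcr : ∀ z ∈ parallelogramEdge τ z₀,
      ContinuousAt (fun z => f z - ∑ p ∈ T, residue f p * (z - p)⁻¹) z := fun z hz =>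
    (hcf z hz).sub (hcs z hz)
  have h0 : boundaryIntegral τ z₀ (fun z => f z - ∑ p ∈ T, residue f p * (z - p)⁻¹) = 0 := by
    refine boundaryIntegral_eq_zero (H := Q) hcr fun z hz => ?_
    have hzT : z ∉ T := fun h => hedge z hz (hTs z h)
    have hzb : z ∈ Metric.ball (0 : ℂ) (‖z₀‖ + 1 + ‖(τ : ℂ)‖ + 1) := by
      obtain ⟨s, hs, t, ht, -, rfl⟩ := hz
      exact add_coord_mem_ball τ z₀ hs ht
    simpa only [div_eq_mul_inv] using hQ z hzb hzT
  have h1 := boundaryIntegral_add hcr hcs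
  simp only [sub_add_cancel] at h1
  rw [h1, h0, zero_add, boundaryIntegral_sum T hci]
  have h2 : ∑ᶠ p ∈ shiftedParallelogram τ z₀, residue f p =
      ∑ p ∈ T with p ∈ shiftedParallelogram τ z₀, residue f p := by
    refine finsum_mem_eq_sum_of_inter_support_eq _ ?_
    ext p
    simp only [Set.mem_inter_iff, Function.mem_support, Finset.coe_filter, Set.mem_ofPred_eq]
    constructor
    · rintro ⟨hp, hr⟩
      refine ⟨⟨?_, hp⟩, hr⟩
      rw [← Finset.mem_coe, hT]
      refine ⟨fun ha => hr (residue_eq_zero_of_analyticAt ha), ?_⟩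
      have := add_coord_mem_ball τ z₀ (Set.Ico_subset_Icc_self hp.1)
        (Set.Ico_subset_Icc_self hp.2)
      rwa [coord_eq, add_sub_cancel] at this
    · rintro ⟨⟨-, hp⟩, hr⟩
      exact ⟨hp, hr⟩
  rw [h2, Finset.sum_filter, Finset.mul_sum]
  refine Finset.sum_congr rfl fun p hp => ?_
  rw [boundaryIntegral_const_mul, boundaryIntegral_inv fun h => hedge p h (hTs p hp)]
  split_ifs <;> ring


/-! ### The Poincaré pairing in terms of periods -/

/-- Two local primitives differ by a constant on a punctured disc, which is connected, and a
constant does not affect the residue. The arbitrary choice in `localPrimitive` is thus harmless. -/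
theorem residue_localPrimitive {φ G : ℂ → ℂ} {p : ℂ} (hG : MeromorphicAt G p)
    (h : IsLocalPrimitive φ p G) : residue (localPrimitive φ p) p = residue G p := by
  have hex : ∃ G, IsLocalPrimitive φ p G := ⟨G, h⟩
  have hL : IsLocalPrimitive φ p (localPrimitive φ p) := by
    rw [localPrimitive, dif_pos hex]; exact hex.choose_spec
  set L := localPrimitive φ p
  have h0 := hL.and h
  rw [eventually_nhdsWithin_iff, Metric.eventually_nhds_iff_ball] at h0
  obtain ⟨r, hr, hb⟩ := h0
  have hb' : ∀ z ∈ Metric.ball p r \ {p}, HasDerivAt L (φ z) z ∧ HasDerivAt G (φ z) z :=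
    fun z hz => hb z hz.1 hz.2
  have hU : IsOpen (Metric.ball p r \ {p}) := Metric.isOpen_ball.sdiff isClosed_singleton
  obtain ⟨w, hwb, hwp⟩ : (Metric.ball p r ∩ ({p} : Set ℂ)ᶜ).Nonempty :=
    ((Set.countable_singleton p).dense_compl ℝ).inter_open_nonempty _ Metric.isOpen_ball
      ⟨p, Metric.mem_ball_self hr⟩
  have hmem : Metric.ball p r \ {p} ∈ 𝓝[≠] p :=
    Filter.inter_mem (mem_nhdsWithin_of_mem_nhds (Metric.ball_mem_nhds p hr)) self_mem_nhdsWithin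
  have hLG : (fun z => G z + (L w - G w)) =ᶠ[𝓝[≠] p] L := by
    filter_upwards [hmem] with z hz
    have := primitive_sub_eq hU
      (ball_diff_countable_isPreconnected (Set.countable_singleton p) p hr)
      (fun z hz => (hb' z hz).1) (fun z hz => (hb' z hz).2) hz ⟨hwb, hwp⟩
    linear_combination -this
  rw [← residue_congr (hG.add (MeromorphicAt.const _ _)) hLG]
  exact residue_add_analyticAt hG analyticAt_const

theorem mem_parallelogram_iff {τ : UpperHalfPlane} {z : ℂ} :
    z ∈ parallelogram τ ↔ coordOne τ z ∈ Set.Ico (0 : ℝ) 1 ∧ coordTau τ z ∈ Set.Ico (0 : ℝ) 1 := by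
  constructor
  · rintro ⟨x, hx, y, hy, rfl⟩
    rw [coordOne_add, coordTau_add]
    exact ⟨hx, hy⟩
  · exact fun h => ⟨_, h.1, _, h.2, (coord_eq τ z).symm⟩

/-- The representative of `z` modulo `Λ_τ` in the fundamental parallelogram. -/
noncomputable def latticeFract (τ : UpperHalfPlane) (z : ℂ) : ℂ :=
  Int.fract (coordOne τ z) + Int.fract (coordTau τ z) * (τ : ℂ)

theorem latticeFract_eq (τ : UpperHalfPlane) (z : ℂ) :
    latticeFract τ z = z + (((-⌊coordOne τ z⌋ : ℤ) : ℂ) + ((-⌊coordTau τ z⌋ : ℤ) : ℂ) * τ) := by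
  rw [latticeFract, Int.fract, Int.fract]
  push_cast
  linear_combination coord_eq τ z

theorem latticeFract_mem (τ : UpperHalfPlane) (z : ℂ) : latticeFract τ z ∈ parallelogram τ :=
  ⟨_, ⟨Int.fract_nonneg _, Int.fract_lt_one _⟩, _, ⟨Int.fract_nonneg _, Int.fract_lt_one _⟩, rfl⟩

theorem latticeFract_add (τ : UpperHalfPlane) (z : ℂ) (m n : ℤ) :
    latticeFract τ (z + ((m : ℂ) + (n : ℂ) * τ)) = latticeFract τ z := by
  have e : z + ((m : ℂ) + (n : ℂ) * τ) =
      ((coordOne τ z + m : ℝ) : ℂ) + ((coordTau τ z + n : ℝ) : ℂ) * τ := by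
    nth_rw 1 [← coord_eq τ z]
    push_cast; ring
  rw [e, latticeFract, coordOne_add, coordTau_add, Int.fract_add_intCast, Int.fract_add_intCast,
    latticeFract]

theorem latticeFract_of_mem {τ : UpperHalfPlane} {z : ℂ} (hz : z ∈ parallelogram τ) :
    latticeFract τ z = z := by
  rw [mem_parallelogram_iff] at hz
  rw [latticeFract, Int.fract_eq_self.2 hz.1, Int.fract_eq_self.2 hz.2, coord_eq]

/-- A sum over `E_τ` does not depend on the fundamental parallelogram. -/
theorem finsum_parallelogram_eq {τ : UpperHalfPlane} {r : ℂ → ℂ} (hr : IsLatticePeriodic τ r)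
    (z₀ : ℂ) : ∑ᶠ p ∈ parallelogram τ, r p = ∑ᶠ p ∈ shiftedParallelogram τ z₀, r p := by
  have hfr : ∀ z, r (z₀ + latticeFract τ (z - z₀)) = r z := fun z => by
    rw [latticeFract_eq, ← hr (-⌊coordOne τ (z - z₀)⌋) (-⌊coordTau τ (z - z₀)⌋) z]
    congr 1
    ring
  refine finsum_mem_eq_of_bijOn (fun p => z₀ + latticeFract τ (p - z₀)) ⟨?_, ?_, ?_⟩
    fun p _ => (hfr p).symm
  · intro p _
    change _ ∧ _
    rw [add_sub_cancel_left]
    exact mem_parallelogram_iff.1 (latticeFract_mem τ _)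
  · intro p hp q hq h
    have h1 : latticeFract τ (p - z₀) = latticeFract τ (q - z₀) := add_left_cancel h
    rw [latticeFract_eq, latticeFract_eq] at h1
    have h2 : q = p + (((-⌊coordOne τ (p - z₀)⌋ + ⌊coordOne τ (q - z₀)⌋ : ℤ) : ℂ) +
        ((-⌊coordTau τ (p - z₀)⌋ + ⌊coordTau τ (q - z₀)⌋ : ℤ) : ℂ) * τ) := by
      push_cast at h1 ⊢
      linear_combination -h1
    rw [← latticeFract_of_mem hp, ← latticeFract_of_mem hq, h2, latticeFract_add]
  · intro w hw
    refine ⟨latticeFract τ w, latticeFract_mem τ w, ?_⟩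
    change z₀ + latticeFract τ (latticeFract τ w - z₀) = w
    have e : latticeFract τ w - z₀ = (w - z₀) +
        (((-⌊coordOne τ w⌋ : ℤ) : ℂ) + ((-⌊coordTau τ w⌋ : ℤ) : ℂ) * τ) := by
      rw [latticeFract_eq]; ring
    rw [e, latticeFract_add, latticeFract_of_mem (mem_parallelogram_iff.2 hw)]
    ring

namespace IsPeriodicPrimitive

variable {τ : UpperHalfPlane} {φ G : ℂ → ℂ} {ω₁ ω₂ : ℂ}

theorem singularSet_subset (h : IsPeriodicPrimitive τ φ G ω₁ ω₂) :
    singularSet G ⊆ singularSet φ := by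
  intro z hz
  by_contra hzφ
  refine hz (analyticAt_of_eventually_hasDerivAt (h := φ) ?_)
  filter_upwards [(isClosed_singularSet φ).isOpen_compl.eventually_mem hzφ] with w hw
  exact h.hasDerivAt w hw

/-- Although `G` is not periodic, its translates differ from it by constants, which have no residue.
The sum of its residues may therefore be taken over any period parallelogram. -/
theorem isLatticePeriodic_residue (h : IsPeriodicPrimitive τ φ G ω₁ ω₂) (hφ : Meromorphic φ) :
    IsLatticePeriodic τ (residue G) := by
  intro m n p
  set l : ℂ := (m : ℂ) + (n : ℂ) * τ
  obtain ⟨Q, -, hQ⟩ := exists_local_primitive_residue (h.meromorphic p)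
  refine residue_eq (h.meromorphic _)
    (Q := fun z => Q (z - l) + ((m : ℂ) * ω₁ + n * ω₂) * z) ?_
  have ht : Filter.Tendsto (fun z => z - l) (𝓝[≠] (p + l)) (𝓝[≠] p) := by
    refine tendsto_nhdsWithin_of_tendsto_nhds_of_eventually_within _ ?_ ?_
    · refine (Continuous.tendsto' (by fun_prop) _ _ (by simp)).mono_left nhdsWithin_le_nhds
    · filter_upwards [self_mem_nhdsWithin] with z hz
      exact fun h => hz (by rw [← Set.mem_singleton_iff.1 h]; simp)
  filter_upwards [ht.eventually hQ, ht.eventually (eventually_notMem_singularSet (hφ p))]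
    with z hz hzS
  have h1 := h.add_period m n _ hzS
  rw [sub_add_cancel] at h1
  have h2 : HasDerivAt (fun z => Q (z - l)) _ z := hz.comp_sub_const z l
  refine (h2.fun_add ((hasDerivAt_id z).const_mul ((m : ℂ) * ω₁ + n * ω₂))).congr_deriv ?_
  rw [h1, sub_sub, add_comm l p]
  ring

/-- The Legendre relation. -/
theorem legendre (h : IsPeriodicPrimitive τ φ G ω₁ ω₂) (hφ : Meromorphic φ)
    (hper : IsLatticePeriodic τ φ) :
    2 * Real.pi * Complex.I * poincarePairing τ φ (fun _ => 1) = ω₁ * τ - ω₂ := by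
  -- The parallelogram at the origin may have poles on its boundary; the corner is moved to a `z₀`
  -- for which the boundary has none.
  obtain ⟨z₀, hz1, hzτ⟩ := exists_lines_avoiding τ (countable_singularSet hφ)
  have hpair : poincarePairing τ φ (fun _ => 1) =
      ∑ᶠ p ∈ shiftedParallelogram τ z₀, residue G p := by
    rw [← finsum_parallelogram_eq (h.isLatticePeriodic_residue hφ), poincarePairing]
    refine finsum_mem_congr rfl fun p _ => ?_
    simp only [mul_one]
    refine residue_localPrimitive (h.meromorphic p) ?_
    exact (eventually_notMem_singularSet (hφ p)).mono fun z hz => h.hasDerivAt z hz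
  have hz1' : ∀ t : ℝ, z₀ + τ + t ∉ singularSet φ := fun t ht => by
    refine hz1 t ((hper.singularSet_iff 0 1 _).1 ?_)
    convert ht using 1
    push_cast; ring
  have hzτ' : ∀ t : ℝ, z₀ + 1 + t * (τ : ℂ) ∉ singularSet φ := fun t ht => by
    refine hzτ t ((hper.singularSet_iff 1 0 _).1 ?_)
    convert ht using 1
    push_cast; ring
  have hedge : ∀ z ∈ parallelogramEdge τ z₀, z ∉ singularSet φ := by
    rintro z ⟨s, -, t, -, (rfl | rfl | rfl | rfl), rfl⟩
    · simpa using hzτ t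
    · simpa [add_assoc] using hzτ' t
    · simpa using hz1 s
    · rw [show z₀ + ((s : ℂ) + ((1 : ℝ) : ℂ) * (τ : ℂ)) = z₀ + τ + s by push_cast; ring]
      exact hz1' s
  have hG : ∀ z ∉ singularSet φ, ContinuousAt G z := fun z hz => (h.hasDerivAt z hz).continuousAt
  rw [hpair, ← boundaryIntegral_eq_sum_residue h.meromorphic
    fun z hz hzG => hedge z hz (h.singularSet_subset hzG), boundaryIntegral]
  -- On opposite edges the values of `G` differ by a period, so only the constants `ω₁ τ` and `ω₂`
  -- survive in the boundary integral.
  have e1 : segmentIntegral G (z₀ + τ) 1 = segmentIntegral G z₀ 1 + ω₂ := by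
    have : ∀ t : ℝ, G (z₀ + τ + t * 1) * 1 = G (z₀ + t * 1) * 1 + ω₂ := fun t => by
      rw [mul_one, mul_one, mul_one, ← h.add_tau (hz1 t)]
      congr 1; ring
    simp only [segmentIntegral, this]
    rw [intervalIntegral.integral_add (intervalIntegrable_segment fun t _ =>
      hG _ (by simpa using hz1 t)) intervalIntegrable_const]
    simp
  have e2 : segmentIntegral G (z₀ + 1) τ = segmentIntegral G z₀ τ + ω₁ * τ := by
    have : ∀ t : ℝ, G (z₀ + 1 + t * (τ : ℂ)) * τ = G (z₀ + t * (τ : ℂ)) * τ + ω₁ * τ := fun t => by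
      rw [← add_mul, ← h.add_one (hzτ t)]
      congr 2; ring
    simp only [segmentIntegral, this]
    rw [intervalIntegral.integral_add (intervalIntegrable_segment fun t _ => hG _ (hzτ t))
      intervalIntegrable_const]
    simp
  rw [e1, e2]; ring

end IsPeriodicPrimitive


/-! ### The Wirtinger derivative -/

theorem dZ_eq_of_hasFDerivAt {b : ℂ → ℂ} {L : ℂ →L[ℝ] ℂ} {z : ℂ} (h : HasFDerivAt b L z) :
    dZ b z = (L 1 - Complex.I * L Complex.I) / 2 := by
  rw [dZ, h.fderiv]

theorem dZ_congr {b b' : ℂ → ℂ} {z : ℂ} (h : b =ᶠ[𝓝 z] b') : dZ b z = dZ b' z := by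
  rw [dZ, dZ, h.fderiv_eq]

theorem dZ_of_hasDerivAt {b : ℂ → ℂ} {d z : ℂ} (h : HasDerivAt b d z) : dZ b z = d := by
  rw [dZ_eq_of_hasFDerivAt (h.hasFDerivAt.restrictScalars ℝ)]
  simp
  linear_combination (-d / 2) * Complex.I_sq

theorem dZ_mul {f g : ℂ → ℂ} {z : ℂ} (hf : DifferentiableAt ℝ f z) (hg : DifferentiableAt ℝ g z) :
    dZ (fun w => f w * g w) z = f z * dZ g z + g z * dZ f z := by
  rw [dZ_eq_of_hasFDerivAt (hf.hasFDerivAt.fun_mul hg.hasFDerivAt), dZ, dZ]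
  simp
  ring

theorem dZ_add {f g : ℂ → ℂ} {z : ℂ} (hf : DifferentiableAt ℝ f z) (hg : DifferentiableAt ℝ g z) :
    dZ (fun w => f w + g w) z = dZ f z + dZ g z := by
  rw [dZ_eq_of_hasFDerivAt (hf.hasFDerivAt.fun_add hg.hasFDerivAt), dZ, dZ]
  simp
  ring

theorem dZ_sub {f g : ℂ → ℂ} {z : ℂ} (hf : DifferentiableAt ℝ f z) (hg : DifferentiableAt ℝ g z) :
    dZ (fun w => f w - g w) z = dZ f z - dZ g z := by
  rw [dZ_eq_of_hasFDerivAt (hf.hasFDerivAt.fun_sub hg.hasFDerivAt), dZ, dZ]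
  simp
  ring

theorem dZ_const_mul_conj (c z : ℂ) : dZ (fun w => c * (starRingEnd ℂ) w) z = 0 := by
  have h : HasFDerivAt (fun w : ℂ => c * (starRingEnd ℂ) w)
      (c • (Complex.conjCLE : ℂ →L[ℝ] ℂ)) z :=
    (Complex.conjCLE : ℂ →L[ℝ] ℂ).hasFDerivAt.const_mul c
  rw [dZ_eq_of_hasFDerivAt h]
  simp
  linear_combination c * Complex.I_sq

theorem contDiffAt_dZ {s : ℂ → ℂ} {p : ℂ} (hs : ContDiffAt ℝ ∞ s p) : ContDiffAt ℝ ∞ (dZ s) p := by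
  have h : ContDiffAt ℝ ∞ (fderiv ℝ s) p := hs.fderiv_right (by simp)
  have h1 : ∀ v : ℂ, ContDiffAt ℝ ∞ (fun z => fderiv ℝ s z v) p := fun v =>
    h.clm_apply contDiffAt_const
  exact ((h1 1).sub (contDiffAt_const.mul (h1 Complex.I))).div_const 2

theorem eventually_differentiableAt {s : ℂ → ℂ} {p : ℂ} (hs : ContDiffAt ℝ ∞ s p) :
    ∀ᶠ z in 𝓝 p, DifferentiableAt ℝ s z := by
  have h1 : ContDiffAt ℝ 1 s p := hs.of_le (by exact_mod_cast le_top)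
  exact (h1.eventually (by simp)).mono fun z hz => hz.differentiableAt one_ne_zero

theorem contDiffAt_sub_pow (p q : ℂ) (n : ℕ) : ContDiffAt ℝ ∞ (fun z : ℂ => (z - p) ^ n) q :=
  (contDiffAt_id.sub contDiffAt_const).pow n

/-- A function with a pole whose Wirtinger derivative has at most a simple pole is smooth. -/
theorem exists_smooth_of_dZ_simple_pole (p : ℂ) (n : ℕ) : ∀ β s t : ℂ → ℂ,
    ContDiffAt ℝ ∞ s p → ContDiffAt ℝ ∞ t p → (∀ᶠ z in 𝓝[≠] p, β z = s z / (z - p) ^ n) →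
    (∀ᶠ z in 𝓝[≠] p, dZ β z = t z / (z - p)) →
    ∃ s₀ : ℂ → ℂ, ContDiffAt ℝ ∞ s₀ p ∧ ∀ᶠ z in 𝓝[≠] p, β z = s₀ z := by
  induction n with
  | zero =>
    intro β s t hs _ hβ _
    exact ⟨s, hs, hβ.mono fun z hz => by simpa using hz⟩
  | succ n ih =>
    intro β s t hs ht hβ hd
    have hn : ((n : ℂ) + 1) ≠ 0 := by exact_mod_cast Nat.succ_ne_zero n
    -- Differentiating `β = s / (z - p) ^ (n + 1)` and equating with `t / (z - p)` gives `(n + 1) s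
    -- = (z - p) (∂s - (z - p) ^ n t)`. Thus `s` is divisible by `z - p` with smooth quotient, and
    -- the pole order drops by one.
    refine ih β (fun z => (dZ s z - (z - p) ^ n * t z) / (n + 1)) t ?_ ht ?_ hd
    · exact ((contDiffAt_dZ hs).sub ((contDiffAt_sub_pow p p n).mul ht)).div_const _
    · filter_upwards [hβ, hd, eventually_nhdsNE_nhds hβ, self_mem_nhdsWithin,
        (eventually_differentiableAt hs).filter_mono nhdsWithin_le_nhds] with z hz hdz hzn hzp hsz
      have hu : z - p ≠ 0 := sub_ne_zero.2 hzp
      have h1 : HasDerivAt (fun z : ℂ => ((z - p) ^ (n + 1))⁻¹)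
          (-(((n + 1 : ℕ) : ℂ) * (z - p) ^ n * 1) / ((z - p) ^ (n + 1)) ^ 2) z :=
        (((hasDerivAt_id z).sub_const p).fun_pow (n + 1)).fun_inv (pow_ne_zero _ hu)
      have h2 : dZ β z = s z * (-(((n + 1 : ℕ) : ℂ) * (z - p) ^ n * 1) / ((z - p) ^ (n + 1)) ^ 2)
          + ((z - p) ^ (n + 1))⁻¹ * dZ s z := by
        rw [dZ_congr (b' := fun z => s z * ((z - p) ^ (n + 1))⁻¹)
          (hzn.mono fun w hw => by rw [hw, div_eq_mul_inv]),
          dZ_mul hsz (h1.differentiableAt.restrictScalars ℝ), dZ_of_hasDerivAt h1]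
      rw [hdz] at h2
      rw [hz]
      push_cast at h2
      field_simp at h2
      have key : s z * (n + 1) = (z - p) * (dZ s z - (z - p) ^ n * t z) := by
        apply mul_left_cancel₀ (pow_ne_zero (n + 1) hu)
        linear_combination h2
      rw [div_div, div_eq_div_iff (pow_ne_zero _ hu) (mul_ne_zero hn (pow_ne_zero _ hu))]
      linear_combination (z - p) ^ n * key

/-- Take the limit over the punctured neighbourhood at every point. As this involves no choice, it
inherits lattice periodicity. -/
theorem exists_smooth_extension {β : ℂ → ℂ}
    (h : ∀ p, ∃ s₀ : ℂ → ℂ, ContDiffAt ℝ ∞ s₀ p ∧ ∀ᶠ z in 𝓝[≠] p, β z = s₀ z) :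
    ∃ B : ℂ → ℂ, ContDiff ℝ ∞ B ∧ (∀ τ, IsLatticePeriodic τ β → IsLatticePeriodic τ B) ∧
      ∀ z, ContinuousAt β z → B z = β z := by
  let B : ℂ → ℂ := fun z => Filter.limUnder (𝓝[≠] z) β
  have hB : ∀ (p : ℂ) (s₀ : ℂ → ℂ), ContinuousAt s₀ p → (∀ᶠ z in 𝓝[≠] p, β z = s₀ z) →
      B p = s₀ p := fun p s₀ hc he => by
    have : Filter.Tendsto β (𝓝[≠] p) (𝓝 (s₀ p)) :=
      (hc.tendsto.mono_left nhdsWithin_le_nhds).congr' (he.mono fun z hz => hz.symm)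
    exact this.limUnder_eq
  refine ⟨B, contDiff_iff_contDiffAt.2 fun p => ?_, fun τ hper m n z => ?_, fun z hz =>
    hB z β hz (Filter.Eventually.of_forall fun _ => rfl)⟩
  · obtain ⟨s₀, hs, he⟩ := h p
    refine hs.congr_of_eventuallyEq ?_
    have h1 : ∀ᶠ z in 𝓝[≠] p, B z = s₀ z := by
      filter_upwards [eventually_nhdsNE_nhds he,
        (eventually_differentiableAt hs).filter_mono nhdsWithin_le_nhds] with z hz hzd
      exact hB z s₀ hzd.continuousAt (hz.filter_mono nhdsWithin_le_nhds)
    rw [eventually_nhdsWithin_iff] at h1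
    filter_upwards [h1] with z hz
    by_cases hzp : z = p
    · rw [hzp]; exact hB p s₀ hs.continuousAt he
    · exact hz hzp
  · obtain ⟨s₀, hs, he⟩ := h z
    rw [hB z s₀ hs.continuousAt he]
    set l : ℂ := (m : ℂ) + (n : ℂ) * τ
    have ht : Filter.Tendsto (fun w => w - l) (𝓝[≠] (z + l)) (𝓝[≠] z) := by
      refine tendsto_nhdsWithin_of_tendsto_nhds_of_eventually_within _ ?_ ?_
      · refine (Continuous.tendsto' (by fun_prop) _ _ (by simp)).mono_left nhdsWithin_le_nhds
      · filter_upwards [self_mem_nhdsWithin] with w hw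
        exact fun h => hw (by rw [← Set.mem_singleton_iff.1 h]; simp)
    have := hB (z + l) (fun w => s₀ (w - l)) ?_ ?_
    · simpa using this
    · refine ContinuousAt.comp (f := fun w => w - l) ?_ (by fun_prop)
      simpa using hs.continuousAt
    · filter_upwards [ht.eventually he] with w hw
      rw [← hw, hper.sub_eq m n w]

/-! ### Integration over the parallelogram -/

/-- The linear map `x + i y ↦ x + y τ`. -/
noncomputable def latticeMap (τ : UpperHalfPlane) : ℂ →L[ℝ] ℂ :=
  Complex.ofRealCLM.comp Complex.reCLM + (Complex.ofRealCLM.comp Complex.imCLM).smulRight (τ : ℂ)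

theorem latticeMap_apply (τ : UpperHalfPlane) (z : ℂ) :
    latticeMap τ z = z.re + z.im * (τ : ℂ) := by
  simp [latticeMap]

theorem det_latticeMap (τ : UpperHalfPlane) : (latticeMap τ).det = τ.im := by
  rw [ContinuousLinearMap.det, ← LinearMap.det_toMatrix Complex.basisOneI, Matrix.det_fin_two]
  simp [LinearMap.toMatrix_apply, latticeMap_apply]

theorem latticeMap_injective (τ : UpperHalfPlane) : Function.Injective (latticeMap τ) := by
  intro z w h
  rw [latticeMap_apply, latticeMap_apply] at h
  apply Complex.ext
  · rw [← coordOne_add τ z.re z.im, h, coordOne_add]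
  · rw [← coordTau_add τ z.re z.im, h, coordTau_add]

theorem image_latticeMap (τ : UpperHalfPlane) :
    latticeMap τ '' (Set.Ico (0 : ℝ) 1 ×ℂ Set.Ico (0 : ℝ) 1) = parallelogram τ := by
  ext z
  constructor
  · rintro ⟨w, hw, rfl⟩
    exact ⟨w.re, hw.1, w.im, hw.2, latticeMap_apply τ w⟩
  · rintro ⟨x, hx, y, hy, rfl⟩
    exact ⟨⟨x, y⟩, ⟨hx, hy⟩, latticeMap_apply τ _⟩

theorem measurableSet_unitSquare : MeasurableSet (Set.Ico (0 : ℝ) 1 ×ℂ Set.Ico (0 : ℝ) 1) :=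
  (measurableSet_Ico.preimage Complex.measurable_re).inter
    (measurableSet_Ico.preimage Complex.measurable_im)

theorem integral_parallelogram (τ : UpperHalfPlane) {f : ℂ → ℂ} (hf : Continuous f) :
    ∫ z in parallelogram τ, f z =
      τ.im * ∫ x in (0 : ℝ)..1, ∫ y in (0 : ℝ)..1, f (x + y * (τ : ℂ)) := by
  rw [← image_latticeMap, MeasureTheory.integral_image_eq_integral_abs_det_fderiv_smul _
    measurableSet_unitSquare (fun z _ => (latticeMap τ).hasFDerivAt.hasFDerivWithinAt)
    (latticeMap_injective τ).injOn, det_latticeMap, abs_of_pos τ.im_pos]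
  have hcont : Continuous fun q : ℝ × ℝ => f (q.1 + q.2 * (τ : ℂ)) := by fun_prop
  have h1 : ∫ z in (Set.Ico (0 : ℝ) 1 ×ℂ Set.Ico (0 : ℝ) 1), τ.im • f (latticeMap τ z) =
      ∫ q in Set.Ico (0 : ℝ) 1 ×ˢ Set.Ico (0 : ℝ) 1, τ.im • f (q.1 + q.2 * (τ : ℂ)) := by
    rw [← Complex.volume_preserving_equiv_real_prod.setIntegral_preimage_emb
      (Complex.measurableEquivRealProd.measurableEmbedding)]
    simp only [latticeMap_apply]
    rfl
  rw [h1, MeasureTheory.Measure.volume_eq_prod, MeasureTheory.setIntegral_prod]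
  · simp only [intervalIntegral.integral_of_le zero_le_one,
      MeasureTheory.integral_Ico_eq_integral_Ioc, Complex.real_smul,
      MeasureTheory.integral_const_mul]
  · rw [← MeasureTheory.Measure.volume_eq_prod]
    refine ((hcont.const_smul τ.im).continuousOn.integrableOn_compact
      (isCompact_Icc.prod isCompact_Icc : IsCompact (Set.Icc (0 : ℝ) 1 ×ˢ Set.Icc (0 : ℝ) 1))).mono_set ?_
    exact Set.prod_mono Set.Ico_subset_Icc_self Set.Ico_subset_Icc_self

theorem parallelogram_subset_ball (τ : UpperHalfPlane) :
    parallelogram τ ⊆ Metric.closedBall 0 (‖(0 : ℂ)‖ + 1 + ‖(τ : ℂ)‖ + 1) := by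
  rintro z ⟨x, hx, y, hy, rfl⟩
  have := add_coord_mem_ball τ 0 (Set.Ico_subset_Icc_self hx)
    (Set.Ico_subset_Icc_self hy)
  rw [zero_add] at this
  exact Metric.ball_subset_closedBall this

theorem integrableOn_parallelogram (τ : UpperHalfPlane) {f : ℂ → ℂ} (hf : Continuous f) :
    MeasureTheory.IntegrableOn f (parallelogram τ) :=
  (hf.continuousOn.integrableOn_compact (isCompact_closedBall _ _)).mono_set
    (parallelogram_subset_ball τ)

theorem torusIntegral_const (τ : UpperHalfPlane) (c : ℂ) :
    torusIntegral τ (fun _ => c) = -2 * Complex.I * τ.im * c := by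
  rw [torusIntegral, integral_parallelogram τ continuous_const]
  simp
  ring

/-- Stokes' theorem on the torus. -/
theorem integral_parallelogram_dZ {τ : UpperHalfPlane} {B : ℂ → ℂ} (hB : ContDiff ℝ ∞ B)
    (hper : IsLatticePeriodic τ B) : ∫ z in parallelogram τ, dZ B z = 0 := by
  have hdc : Continuous (dZ B) := continuous_iff_continuousAt.2 fun p =>
    (contDiffAt_dZ hB.contDiffAt).continuousAt
  rw [integral_parallelogram τ hdc]
  have hτ : (τ.im : ℂ) ≠ 0 := by exact_mod_cast τ.im_pos.ne'
  let M : ℝ × ℝ →L[ℝ] ℂ := Complex.ofRealCLM.comp (ContinuousLinearMap.fst ℝ ℝ ℝ) +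
    (Complex.ofRealCLM.comp (ContinuousLinearMap.snd ℝ ℝ ℝ)).smulRight (τ : ℂ)
  have hM : ∀ q : ℝ × ℝ, M q = q.1 + q.2 * (τ : ℂ) := fun q => by simp [M]
  -- In the coordinates `z = x + y τ` the Wirtinger derivative is `c₁ ∂_x + c₂ ∂_y`, a divergence on
  -- the unit square.
  let c₁ : ℂ := (1 + Complex.I * τ.re / τ.im) / 2
  let c₂ : ℂ := - Complex.I / (2 * τ.im)
  have hd : ∀ q, HasFDerivAt (fun q => B (M q)) ((fderiv ℝ B (M q)).comp M) q := fun q =>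
    ((hB.differentiable (by simp)) (M q)).hasFDerivAt.comp q M.hasFDerivAt
  have hsum : ∀ q : ℝ × ℝ, (c₁ • (fderiv ℝ B (M q)).comp M) (1, 0) +
      (c₂ • (fderiv ℝ B (M q)).comp M) (0, 1) = dZ B (q.1 + q.2 * (τ : ℂ)) := by
    intro q
    rw [← hM]
    have e : (M (0, 1)) = τ.re • (1 : ℂ) + τ.im • Complex.I := by
      rw [hM]
      apply Complex.ext <;> simp
    have e' : M (1, 0) = 1 := by rw [hM]; simp
    have e'' : fderiv ℝ B (M q) (M (0, 1)) =
        τ.re * fderiv ℝ B (M q) 1 + τ.im * fderiv ℝ B (M q) Complex.I := by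
      rw [e, map_add, map_smul, map_smul, Complex.real_smul, Complex.real_smul]
    simp only [smul_apply, ContinuousLinearMap.comp_apply, e', e'', dZ, smul_eq_mul, c₁, c₂]
    field_simp
    ring
  have hcB : Continuous fun q => B (M q) := hB.continuous.comp M.continuous
  have key := MeasureTheory.integral2_divergence_prod_of_hasFDerivAt_off_countable
    (fun q => c₁ • B (M q)) (fun q => c₂ • B (M q))
    (fun q => c₁ • (fderiv ℝ B (M q)).comp M) (fun q => c₂ • (fderiv ℝ B (M q)).comp M)
    0 0 1 1 ∅ Set.countable_empty (hcB.const_smul c₁).continuousOn (hcB.const_smul c₂).continuousOn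
    (fun q _ => (hd q).const_smul c₁) (fun q _ => (hd q).const_smul c₂) ?_
  · simp only [hsum] at key
    rw [key]
    -- Periodicity makes the contributions of opposite sides cancel.
    have p1 : ∀ y : ℝ, B (M (1, y)) = B (M (0, y)) := fun y => by
      rw [hM, hM, ← hper 1 0 (((0 : ℝ) : ℂ) + (y : ℂ) * τ)]
      congr 1; push_cast; ring
    have p2 : ∀ x : ℝ, B (M (x, 1)) = B (M (x, 0)) := fun x => by
      rw [hM, hM, ← hper 0 1 ((x : ℂ) + ((0 : ℝ) : ℂ) * τ)]
      congr 1; push_cast; ring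
    simp only [p1, p2]
    simp
  · simp only [hsum]
    refine (Continuous.continuousOn ?_).integrableOn_compact (isCompact_uIcc.prod isCompact_uIcc)
    exact hdc.comp (by fun_prop)

/-! ### The regularized integral -/

/-- Comparison with one decomposition of constant `α` suffices. The difference of the two `β`
satisfies `∂β = a - c`, with at most simple poles, so it extends to a smooth periodic `B`. Then `a =
c + ∂B` off a null set, which gives integrability, and Stokes' theorem removes `∂B`. -/
theorem IsDecomposition.integral_eq {τ : UpperHalfPlane} {D : Set ℂ}
    (hD : ∀ p, ∀ᶠ z in 𝓝[≠] p, z ∉ D) {w a b b₀ : ℂ → ℂ} {c : ℂ}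
    (h : IsDecomposition τ D w a b) (h₀ : IsDecomposition τ D w (fun _ => c) b₀) :
    MeasureTheory.IntegrableOn a (parallelogram τ) ∧
      torusIntegral τ a = torusIntegral τ (fun _ => c) := by
  let β : ℂ → ℂ := fun z => b₀ z - b z
  have hdβ : ∀ z ∉ D, dZ β z = a z - c := by
    intro z hz
    have h1 := (h₀.poles.2.1 z hz).differentiableAt (by simp)
    have h2 := (h.poles.2.1 z hz).differentiableAt (by simp)
    have e : dZ β z = dZ b₀ z - dZ b z := dZ_sub h1 h2
    rw [e]
    linear_combination h.eq z hz - h₀.eq z hz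
  have hsm : ∀ p, ∃ s₀ : ℂ → ℂ, ContDiffAt ℝ ∞ s₀ p ∧ ∀ᶠ z in 𝓝[≠] p, β z = s₀ z := by
    intro p
    by_cases hp : p ∈ D
    · obtain ⟨n, s, hs, hbs⟩ := h.poles.2.2 p hp
      obtain ⟨n', s', hs', hbs'⟩ := h₀.poles.2.2 p hp
      obtain ⟨r, hr, har⟩ := h.log.2.2 p hp
      refine exists_smooth_of_dZ_simple_pole p (n + n') β
        (fun z => s' z * (z - p) ^ n - s z * (z - p) ^ n') (fun z => r z - c * (z - p) ^ 1)
        ((hs'.mul (contDiffAt_sub_pow p p n)).sub (hs.mul (contDiffAt_sub_pow p p n')))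
        (hr.sub (contDiffAt_const.mul (contDiffAt_sub_pow p p 1))) ?_ ?_
      · filter_upwards [hbs, hbs', self_mem_nhdsWithin] with z hz hz' hzp
        have hu : z - p ≠ 0 := sub_ne_zero.2 hzp
        simp only [β]
        rw [hz, hz', pow_add]
        field_simp
      · filter_upwards [har, hD p, self_mem_nhdsWithin] with z hz hzD hzp
        have hu : z - p ≠ 0 := sub_ne_zero.2 hzp
        rw [hdβ z hzD, hz]
        field_simp
    · exact ⟨β, (h₀.poles.2.1 p hp).sub (h.poles.2.1 p hp), Filter.Eventually.of_forall fun _ => rfl⟩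
  obtain ⟨B, hB, hBper, hBβ⟩ := exists_smooth_extension hsm
  have hBper' : IsLatticePeriodic τ B := hBper τ fun m n z => by
    simp only [β]
    rw [h.poles.1 m n z, h₀.poles.1 m n z]
  have hDc : IsClosed D := by
    rw [← isOpen_compl_iff, isOpen_iff_mem_nhds]
    intro p hp
    have := hD p
    rw [eventually_nhdsWithin_iff] at this
    filter_upwards [this] with z hz
    by_cases hzp : z = p
    · exact hzp ▸ hp
    · exact hz hzp
  have hBd : ∀ z ∉ D, dZ B z = a z - c := by
    intro z hz
    rw [← hdβ z hz]
    refine dZ_congr ?_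
    filter_upwards [hDc.isOpen_compl.eventually_mem hz] with w hw
    exact hBβ w ((h₀.poles.2.1 w hw).sub (h.poles.2.1 w hw)).continuousAt
  have hae : (fun z => c + dZ B z) =ᵐ[MeasureTheory.volume.restrict (parallelogram τ)] a := by
    refine MeasureTheory.ae_restrict_of_ae ?_
    have := (countable_of_isolated hD).ae_notMem MeasureTheory.volume
    filter_upwards [this] with z hz
    rw [hBd z hz]; ring
  have hdc : Continuous (dZ B) := continuous_iff_continuousAt.2 fun p =>
    (contDiffAt_dZ hB.contDiffAt).continuousAt
  refine ⟨(integrableOn_parallelogram τ (continuous_const.add hdc)).congr hae, ?_⟩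
  rw [torusIntegral, torusIntegral, ← MeasureTheory.integral_congr_ae hae,
    MeasureTheory.integral_add (integrableOn_parallelogram τ continuous_const)
    (integrableOn_parallelogram τ hdc), integral_parallelogram_dZ hB hBper', add_zero]


namespace IsPeriodicPrimitive

variable {τ : UpperHalfPlane} {φ G : ℂ → ℂ} {ω₁ ω₂ : ℂ}

/-- The primitive, corrected by a real-linear function to become periodic, gives a decomposition
with constant `α`. -/
theorem exists_isDecomposition (h : IsPeriodicPrimitive τ φ G ω₁ ω₂) (hφ : Meromorphic φ)
    (hper : IsLatticePeriodic τ φ) :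
    ∃ b, IsDecomposition τ (singularSet φ) (normalizedForm τ φ)
      (fun _ => Complex.I / 2 / τ.im *
        ((ω₂ - ω₁ * (starRingEnd ℂ) (τ : ℂ)) / (2 * Complex.I * τ.im))) b := by
  classical
  -- The function `A z + (ω₁ - A) z̄` has period `ω₁` along `1` for every `A`; period `ω₂` along `τ`
  -- forces this value.
  set A : ℂ := (ω₂ - ω₁ * (starRingEnd ℂ) (τ : ℂ)) / (2 * Complex.I * τ.im) with hA
  set κ : ℂ := Complex.I / 2 / τ.im
  have hτ : (τ.im : ℂ) ≠ 0 := by exact_mod_cast τ.im_pos.ne'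
  have hAB : A * τ + (ω₁ - A) * (starRingEnd ℂ) (τ : ℂ) = ω₂ := by
    have h1 : (τ : ℂ) - (starRingEnd ℂ) (τ : ℂ) = 2 * Complex.I * τ.im := by
      rw [Complex.sub_conj]; simp; ring
    have h2 : A * (2 * Complex.I * τ.im) = ω₂ - ω₁ * (starRingEnd ℂ) (τ : ℂ) :=
      div_mul_cancel₀ _ (by simp [hτ])
    linear_combination A * h1 + h2
  let E : ℂ → ℂ := fun z => κ * G z - (κ * A * z + κ * (ω₁ - A) * (starRingEnd ℂ) z)
  -- Periodicity is required at every point, but the period relation for `G` is known only off the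
  -- singular set; hence the value `0` there.
  let b : ℂ → ℂ := fun z => if z ∈ singularSet φ then 0 else E z
  have hlin : ContDiff ℝ ∞ fun z : ℂ => κ * A * z + κ * (ω₁ - A) * (starRingEnd ℂ) z :=
    (contDiff_const.mul contDiff_id).add
      (contDiff_const.mul (Complex.conjCLE : ℂ →L[ℝ] ℂ).contDiff)
  have hbE : ∀ z ∉ singularSet φ, b =ᶠ[𝓝 z] E := fun z hz => by
    filter_upwards [(isClosed_singularSet φ).isOpen_compl.eventually_mem hz] with w hw
    exact if_neg hw
  refine ⟨b, ⟨fun _ _ _ => rfl, fun _ _ => contDiffAt_const, fun p _ =>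
    ⟨fun z => κ * A * (z - p), ?_, ?_⟩⟩, ⟨?_, ?_, ?_⟩, ?_⟩
  · exact contDiffAt_const.mul (contDiffAt_id.sub contDiffAt_const)
  · filter_upwards [self_mem_nhdsWithin] with z hz
    have : z - p ≠ 0 := sub_ne_zero.2 hz
    field_simp
  · intro m n z
    by_cases hz : z ∈ singularSet φ
    · simp only [b]
      rw [if_pos hz, if_pos ((hper.singularSet_iff m n z).2 hz)]
    · simp only [b]
      rw [if_neg hz, if_neg (mt (hper.singularSet_iff m n z).1 hz)]
      simp only [E]
      rw [h.add_period m n z hz, ← hAB]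
      simp only [map_add, map_mul, map_intCast]
      ring
  · intro p hp
    refine ContDiffAt.congr_of_eventuallyEq ?_ (hbE p hp)
    have hGa : AnalyticAt ℂ G p := not_not.1 fun hG => hp (h.singularSet_subset hG)
    exact (contDiffAt_const.mul (hGa.contDiffAt.restrict_scalars ℝ)).sub hlin.contDiffAt
  · intro p hp
    obtain ⟨n, hn⟩ := h.meromorphic p
    refine ⟨n, fun z => κ * ((z - p) ^ n • G z) -
      (κ * A * z + κ * (ω₁ - A) * (starRingEnd ℂ) z) * (z - p) ^ n, ?_, ?_⟩
    · exact (contDiffAt_const.mul (hn.contDiffAt.restrict_scalars ℝ)).sub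
        (hlin.contDiffAt.mul (contDiffAt_sub_pow p p n))
    · filter_upwards [self_mem_nhdsWithin, eventually_notMem_singularSet (hφ p)] with z hz hzS
      have : z - p ≠ 0 := sub_ne_zero.2 hz
      simp only [b, E]
      rw [if_neg hzS, smul_eq_mul]
      field_simp
  · intro z hz
    have hG := h.hasDerivAt z hz
    have h1 : HasDerivAt (fun z => κ * G z) (κ * φ z) z := hG.const_mul κ
    have h2 : HasDerivAt (fun z : ℂ => κ * A * z) (κ * A * 1) z := (hasDerivAt_id z).const_mul _
    have h3 : DifferentiableAt ℝ (fun z : ℂ => κ * (ω₁ - A) * (starRingEnd ℂ) z) z :=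
      ((Complex.conjCLE : ℂ →L[ℝ] ℂ).differentiableAt).const_mul _
    have e : dZ b z = κ * φ z - (κ * A * 1 + 0) := by
      rw [dZ_congr (hbE z hz), dZ_sub (h1.differentiableAt.restrictScalars ℝ)
        ((h2.differentiableAt.restrictScalars ℝ).fun_add h3),
        dZ_add (h2.differentiableAt.restrictScalars ℝ) h3, dZ_of_hasDerivAt h1,
        dZ_of_hasDerivAt h2, dZ_const_mul_conj]
    rw [e, normalizedForm]
    ring

theorem torusIntegral_eq (h : IsPeriodicPrimitive τ φ G ω₁ ω₂) (hφ : Meromorphic φ)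
    (hper : IsLatticePeriodic τ φ) {a b : ℂ → ℂ}
    (hab : IsDecomposition τ (singularSet φ) (normalizedForm τ φ) a b) :
    MeasureTheory.IntegrableOn a (parallelogram τ) ∧
      torusIntegral τ a = (ω₂ - ω₁ * (starRingEnd ℂ) (τ : ℂ)) / (2 * Complex.I * τ.im) := by
  obtain ⟨b₀, hb₀⟩ := h.exists_isDecomposition hφ hper
  obtain ⟨h1, h2⟩ := hab.integral_eq (fun p => eventually_notMem_singularSet (hφ p)) hb₀
  refine ⟨h1, ?_⟩
  have hτ : (τ.im : ℂ) ≠ 0 := by exact_mod_cast τ.im_pos.ne'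
  rw [h2, torusIntegral_const]
  -- The form `d²z / Im τ` has total mass `1`.
  have : -2 * Complex.I * τ.im * (Complex.I / 2 / τ.im) = 1 := by
    field_simp
    rw [Complex.I_sq]
    ring
  rw [← mul_assoc, this, one_mul]

theorem regularizedIntegral_eq (h : IsPeriodicPrimitive τ φ G ω₁ ω₂) (hφ : Meromorphic φ)
    (hper : IsLatticePeriodic τ φ) :
    regularizedIntegral τ (singularSet φ) (normalizedForm τ φ) =
      (ω₂ - ω₁ * (starRingEnd ℂ) (τ : ℂ)) / (2 * Complex.I * τ.im) := by
  obtain ⟨b₀, hb₀⟩ := h.exists_isDecomposition hφ hper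
  have hex : ∃ ab : (ℂ → ℂ) × (ℂ → ℂ),
      IsDecomposition τ (singularSet φ) (normalizedForm τ φ) ab.1 ab.2 := ⟨(_, b₀), hb₀⟩
  rw [regularizedIntegral, dif_pos hex]
  exact (h.torusIntegral_eq hφ hper hex.choose_spec).2

end IsPeriodicPrimitive


/-! ### Holomorphic dependence on `τ` -/

/-- The function on `ℂ × ℂ` given by `Φ` over the upper half-plane. -/
noncomputable def extend (Φ : ℂ → UpperHalfPlane → ℂ) (q : ℂ × ℂ) : ℂ :=
  Φ q.1 (UpperHalfPlane.ofComplex q.2)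

theorem extend_coe (Φ : ℂ → UpperHalfPlane → ℂ) (z : ℂ) (τ : UpperHalfPlane) :
    extend Φ (z, (τ : ℂ)) = Φ z τ := by
  rw [extend, UpperHalfPlane.ofComplex_apply]

theorem IsMeromorphicFamily.eventually_eq_div {Φ : ℂ → UpperHalfPlane → ℂ}
    (hΦ : IsMeromorphicFamily Φ) (z₀ : ℂ) (τ₀ : UpperHalfPlane) : ∃ g h : ℂ × ℂ → ℂ,
    AnalyticAt ℂ g (z₀, (τ₀ : ℂ)) ∧ AnalyticAt ℂ h (z₀, (τ₀ : ℂ)) ∧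
    (∀ᶠ z in 𝓝[≠] z₀, h (z, (τ₀ : ℂ)) ≠ 0) ∧
    ∀ᶠ q in 𝓝 (z₀, (τ₀ : ℂ)), h q ≠ 0 → extend Φ q = g q / h q := by
  obtain ⟨g, h, hg, hh, hne, he⟩ := hΦ z₀ τ₀
  refine ⟨g, h, hg, hh, hne, ?_⟩
  have hof : Filter.Tendsto (fun w : ℂ => UpperHalfPlane.ofComplex w) (𝓝 (τ₀ : ℂ)) (𝓝 τ₀) := by
    have := (UpperHalfPlane.mdifferentiableAt_ofComplex τ₀.im_pos).continuousAt.tendsto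
    rwa [UpperHalfPlane.ofComplex_apply] at this
  have ht : Filter.Tendsto (fun q : ℂ × ℂ => (q.1, UpperHalfPlane.ofComplex q.2))
      (𝓝 (z₀, (τ₀ : ℂ))) (𝓝 (z₀, τ₀)) := by
    rw [nhds_prod_eq, nhds_prod_eq]
    exact Filter.tendsto_fst.prodMk (hof.comp Filter.tendsto_snd)
  have him : ∀ᶠ q : ℂ × ℂ in 𝓝 (z₀, (τ₀ : ℂ)), 0 < q.2.im :=
    (isOpen_lt continuous_const (Complex.continuous_im.comp continuous_snd)).eventually_mem τ₀.im_pos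
  filter_upwards [ht.eventually he, him] with q hq hqi hne
  simp only [UpperHalfPlane.ofComplex_apply_of_im_pos hqi] at hq
  rw [extend, UpperHalfPlane.ofComplex_apply_of_im_pos hqi]
  exact hq hne

theorem tendsto_prodMk_nhdsNE (z₀ τ₀ : ℂ) :
    Filter.Tendsto (fun z : ℂ => (z, τ₀)) (𝓝[≠] z₀) (𝓝 (z₀, τ₀)) :=
  (Continuous.tendsto (by fun_prop) _).mono_left nhdsWithin_le_nhds

theorem analyticAt_prodMk (z₀ τ₀ : ℂ) : AnalyticAt ℂ (fun z : ℂ => (z, τ₀)) z₀ :=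
  analyticAt_id.prod analyticAt_const

theorem IsMeromorphicFamily.meromorphic {Φ : ℂ → UpperHalfPlane → ℂ}
    (hΦ : IsMeromorphicFamily Φ) (τ : UpperHalfPlane) : Meromorphic fun z => Φ z τ := by
  intro z₀
  obtain ⟨g, h, hg, hh, hne, he⟩ := hΦ.eventually_eq_div z₀ τ
  have hg' : AnalyticAt ℂ (fun z => g (z, (τ : ℂ))) z₀ :=
    AnalyticAt.fun_comp (g := g) hg (analyticAt_prodMk z₀ τ)
  have hh' : AnalyticAt ℂ (fun z => h (z, (τ : ℂ))) z₀ :=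
    AnalyticAt.fun_comp (g := h) hh (analyticAt_prodMk z₀ τ)
  refine (hg'.meromorphicAt.fun_div hh'.meromorphicAt).congr ?_
  filter_upwards [hne, (tendsto_prodMk_nhdsNE z₀ τ).eventually he] with z hz hez
  rw [← extend_coe Φ z τ, hez hz]

/-- The points of a fibre where `Φ` is not jointly holomorphic are isolated. -/
theorem IsMeromorphicFamily.eventually_analyticAt {Φ : ℂ → UpperHalfPlane → ℂ}
    (hΦ : IsMeromorphicFamily Φ) (τ : UpperHalfPlane) (z₀ : ℂ) :
    ∀ᶠ z in 𝓝[≠] z₀, AnalyticAt ℂ (extend Φ) (z, (τ : ℂ)) := by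
  obtain ⟨g, h, hg, hh, hne, he⟩ := hΦ.eventually_eq_div z₀ τ
  have ht := tendsto_prodMk_nhdsNE z₀ τ
  filter_upwards [hne, ht.eventually hg.eventually_analyticAt,
    ht.eventually hh.eventually_analyticAt, ht.eventually he.eventually_nhds]
    with z hz hgz hhz hez
  refine (hgz.div hhz hz).congr ?_
  filter_upwards [hez, hhz.continuousAt.eventually_ne hz] with q hq hqne
  exact (hq hqne).symm

theorem analyticAt_fibre {Φ : ℂ → UpperHalfPlane → ℂ} {z : ℂ} {τ : UpperHalfPlane}
    (h : AnalyticAt ℂ (extend Φ) (z, (τ : ℂ))) : AnalyticAt ℂ (fun z => Φ z τ) z := by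
  have := AnalyticAt.fun_comp (g := extend Φ) (f := fun z => (z, (τ : ℂ))) h (analyticAt_prodMk z τ)
  simpa only [extend_coe] using this

/-- Integrals of a holomorphic function of two variables along segments depending holomorphically
on the second variable. -/
theorem differentiableAt_segmentIntegral {F : ℂ × ℂ → ℂ} {a w₀ : ℂ} {l : ℂ → ℂ}
    (hl : ContDiff ℂ 1 l)
    (hF : ∀ t ∈ Set.Icc (0 : ℝ) 1, AnalyticAt ℂ F (a + t * l w₀, w₀)) :
    (∀ᶠ w in 𝓝 w₀, ∀ t ∈ Set.Icc (0 : ℝ) 1, AnalyticAt ℂ F (a + t * l w, w)) ∧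
    DifferentiableAt ℂ (fun w => ∫ t in (0 : ℝ)..1, F (a + t * l w, w) * l w) w₀ := by
  have hld : ∀ w, HasDerivAt l (deriv l w) w := fun w =>
    (hl.differentiable one_ne_zero w).hasDerivAt
  have hlc : Continuous l := hl.continuous
  have hlc' : Continuous (deriv l) := hl.continuous_deriv le_rfl
  let m : ℂ × ℝ → ℂ × ℂ := fun q => (a + q.2 * l q.1, q.1)
  have hm : Continuous m := by fun_prop
  have hopen : IsOpen (m ⁻¹' {q | AnalyticAt ℂ F q}) := (isOpen_analyticAt ℂ F).preimage hm
  -- Joint analyticity is an open condition and the parameter interval is compact, so it persists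
  -- along the segments for all nearby `w`.
  obtain ⟨u, v, hu, -, hwu, hv, huv⟩ := generalized_tube_lemma (s := {w₀})
    (t := Set.Icc (0 : ℝ) 1) isCompact_singleton isCompact_Icc hopen (by
      rintro ⟨w, t⟩ ⟨hw, ht⟩
      rw [Set.mem_singleton_iff] at hw
      subst hw
      exact hF t ht)
  have hA : ∀ w ∈ u, ∀ t ∈ Set.Icc (0 : ℝ) 1, AnalyticAt ℂ F (a + t * l w, w) :=
    fun w hw t ht => huv (show (w, t) ∈ u ×ˢ v from ⟨hw, hv ht⟩)
  have hun : u ∈ 𝓝 w₀ := hu.mem_nhds (hwu rfl)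
  refine ⟨Filter.eventually_of_mem hun hA, ?_⟩
  obtain ⟨ε, hε, hεu⟩ := Metric.nhds_basis_closedBall.mem_iff.1 hun
  -- The `w`-derivative of the integrand; its maximum on a compact set is the dominating constant.
  let D : ℂ × ℝ → ℂ := fun q =>
    fderiv ℂ F (m q) (q.2 * deriv l q.1, 1) * l q.1 + F (m q) * deriv l q.1
  have hDc : ContinuousOn D (Metric.closedBall w₀ ε ×ˢ Set.Icc (0 : ℝ) 1) := by
    intro q hq
    have hq' : AnalyticAt ℂ F (m q) := hA q.1 (hεu hq.1) q.2 hq.2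
    have h1 : ContinuousAt (fun q => F (m q)) q :=
      ContinuousAt.comp (f := m) hq'.continuousAt hm.continuousAt
    have h2 : ContinuousAt (fun q => fderiv ℂ F (m q)) q :=
      ContinuousAt.comp (f := m) hq'.fderiv.continuousAt hm.continuousAt
    have h3 : ContinuousAt (fun q : ℂ × ℝ => ((q.2 : ℂ) * deriv l q.1, (1 : ℂ))) q :=
      Continuous.continuousAt (by fun_prop)
    have h4 : ContinuousAt (fun q : ℂ × ℝ => l q.1) q := Continuous.continuousAt (by fun_prop)
    have h5 : ContinuousAt (fun q : ℂ × ℝ => deriv l q.1) q :=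
      Continuous.continuousAt (by fun_prop)
    exact (((h2.clm_apply h3).mul h4).add (h1.mul h5)).continuousWithinAt
  obtain ⟨C, hC⟩ := ((isCompact_closedBall w₀ ε).prod isCompact_Icc).exists_bound_of_continuousOn hDc
  have hIoc : Set.uIoc (0 : ℝ) 1 ⊆ Set.Icc 0 1 := by
    rw [Set.uIoc_of_le zero_le_one]; exact Set.Ioc_subset_Icc_self
  have hcF : ∀ w ∈ u, ContinuousOn (fun t : ℝ => F (a + t * l w, w) * l w) (Set.Icc 0 1) := by
    intro w hw t ht
    refine (ContinuousAt.mul ?_ continuousAt_const).continuousWithinAt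
    exact ContinuousAt.comp (f := fun t : ℝ => (a + t * l w, w)) (hA w hw t ht).continuousAt
      (Continuous.continuousAt (by fun_prop))
  have hsm : ∀ {f : ℝ → ℂ}, ContinuousOn f (Set.Icc 0 1) → MeasureTheory.AEStronglyMeasurable f
      (MeasureTheory.volume.restrict (Set.uIoc (0 : ℝ) 1)) := fun hf =>
    (hf.mono hIoc).aestronglyMeasurable measurableSet_uIoc
  refine (intervalIntegral.hasDerivAt_integral_of_dominated_loc_of_deriv_le
    (F' := fun w t => D (w, t)) (bound := fun _ => C) (Metric.closedBall_mem_nhds w₀ hε)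
    ?_ ?_ ?_ ?_ intervalIntegrable_const ?_).2.differentiableAt
  · exact Filter.eventually_of_mem hun fun w hw => hsm (hcF w hw)
  · exact ContinuousOn.intervalIntegrable (by rw [uIcc_zero_one]; exact hcF w₀ (hwu rfl))
  · refine hsm (hDc.comp (f := fun t : ℝ => (w₀, t)) (by fun_prop) fun t ht => ?_)
    exact ⟨Metric.mem_closedBall_self hε.le, ht⟩
  · exact Filter.Eventually.of_forall fun t ht w hw => hC (w, t) ⟨hw, hIoc ht⟩
  · refine Filter.Eventually.of_forall fun t ht w hw => ?_
    have h1 : HasDerivAt (fun w => (a + t * l w, w)) ((t : ℂ) * deriv l w, (1 : ℂ)) w :=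
      (((hld w).const_mul (t : ℂ)).const_add a).prodMk (hasDerivAt_id w)
    have h2 := (hA w (hεu hw) t (hIoc ht)).differentiableAt.hasFDerivAt
    have h3 : HasDerivAt (fun w => F (a + t * l w, w)) _ w :=
      HasFDerivAt.comp_hasDerivAt (f := fun w => (a + t * l w, w)) w h2 h1
    exact h3.fun_mul (hld w)

/-- The periods of a family of second kind differentials are holomorphic. -/
theorem mdifferentiable_periods {Φ : ℂ → UpperHalfPlane → ℂ} (hΦ : IsMeromorphicFamily Φ)
    {G : UpperHalfPlane → ℂ → ℂ} {ω₁ ω₂ : UpperHalfPlane → ℂ}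
    (h : ∀ τ, IsPeriodicPrimitive τ (fun z => Φ z τ) (G τ) (ω₁ τ) (ω₂ τ)) :
    MDifferentiable 𝓘(ℂ) 𝓘(ℂ) ω₁ ∧ MDifferentiable 𝓘(ℂ) 𝓘(ℂ) ω₂ := by
  -- The primitives `G τ` need not vary regularly with `τ`. Near `τ₀` the periods are instead
  -- written as integrals of `Φ` from a fixed base point `z₀` to `z₀ + 1` and `z₀ + w`.
  have key : ∀ τ₀ : UpperHalfPlane, ∃ z₀ : ℂ,
      (∀ t : ℝ, AnalyticAt ℂ (extend Φ) (z₀ + t * (fun _ : ℂ => (1 : ℂ)) τ₀, (τ₀ : ℂ))) ∧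
      (∀ t : ℝ, AnalyticAt ℂ (extend Φ) (z₀ + t * (fun w : ℂ => w) τ₀, (τ₀ : ℂ))) := by
    intro τ₀
    obtain ⟨z₀, h1, h2⟩ := exists_lines_avoiding τ₀ (countable_of_isolated
      (S := {z | ¬ AnalyticAt ℂ (extend Φ) (z, (τ₀ : ℂ))})
      fun p => (hΦ.eventually_analyticAt τ₀ p).mono fun z hz => not_not.2 hz)
    exact ⟨z₀, fun t => by simpa using h1 t, fun t => not_not.1 (h2 t)⟩
  have him : ∀ τ₀ : UpperHalfPlane, ∀ᶠ w in 𝓝 (τ₀ : ℂ), 0 < w.im := fun τ₀ =>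
    (isOpen_lt continuous_const Complex.continuous_im).eventually_mem τ₀.im_pos
  have hseg : ∀ (τ : UpperHalfPlane) (a l : ℂ),
      (∀ t ∈ Set.Icc (0 : ℝ) 1, AnalyticAt ℂ (extend Φ) (a + t * l, (τ : ℂ))) →
      (a ∉ singularSet fun z => Φ z τ) ∧
      ∫ t in (0 : ℝ)..1, extend Φ (a + t * l, (τ : ℂ)) * l = G τ (a + l) - G τ a := by
    intro τ a l hA
    refine ⟨fun hs => hs (by simpa using analyticAt_fibre (hA 0 (by simp))), ?_⟩
    simp only [extend_coe]
    exact (h τ).segment_integral a l fun t ht hs => hs (analyticAt_fibre (hA t ht))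
  constructor
  · intro τ₀
    rw [UpperHalfPlane.mdifferentiableAt_iff]
    obtain ⟨z₀, hz, -⟩ := key τ₀
    obtain ⟨hev, hd⟩ := differentiableAt_segmentIntegral contDiff_const fun t _ => hz t
    refine hd.congr_of_eventuallyEq ?_
    filter_upwards [hev, him τ₀] with w hw hwi
    lift w to UpperHalfPlane using hwi
    obtain ⟨hs, hi⟩ := hseg w z₀ 1 hw
    rw [Function.comp_apply, UpperHalfPlane.ofComplex_apply, hi, (h w).add_one hs]
    ring
  · intro τ₀
    rw [UpperHalfPlane.mdifferentiableAt_iff]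
    obtain ⟨z₀, -, hz⟩ := key τ₀
    obtain ⟨hev, hd⟩ := differentiableAt_segmentIntegral contDiff_id fun t _ => hz t
    refine hd.congr_of_eventuallyEq ?_
    filter_upwards [hev, him τ₀] with w hw hwi
    lift w to UpperHalfPlane using hwi
    obtain ⟨hs, hi⟩ := hseg w z₀ w hw
    rw [Function.comp_apply, UpperHalfPlane.ofComplex_apply]
    simp only [id]
    rw [hi, (h w).add_tau hs]
    ring

/-! ### Modularity of the periods -/

theorem autFactor_ne_zero (γ : Matrix.SpecialLinearGroup (Fin 2) ℤ) (τ : UpperHalfPlane) :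
    autFactor γ τ ≠ 0 := by
  have := UpperHalfPlane.denom_ne_zero (γ : Matrix.GeneralLinearGroup (Fin 2) ℝ) τ
  simpa [autFactor, UpperHalfPlane.denom] using this

theorem coe_smul_eq (γ : Matrix.SpecialLinearGroup (Fin 2) ℤ) (τ : UpperHalfPlane) :
    ((γ • τ : UpperHalfPlane) : ℂ) =
      (((γ 0 0 : ℤ) : ℂ) * τ + ((γ 0 1 : ℤ) : ℂ)) / autFactor γ τ := by
  rw [UpperHalfPlane.coe_specialLinearGroup_apply]
  simp [autFactor]

theorem det_eq_one (γ : Matrix.SpecialLinearGroup (Fin 2) ℤ) :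
    ((γ 0 0 : ℤ) : ℂ) * ((γ 1 1 : ℤ) : ℂ) - ((γ 0 1 : ℤ) : ℂ) * ((γ 1 0 : ℤ) : ℂ) = 1 := by
  have := γ.det_coe
  rw [Matrix.det_fin_two] at this
  exact_mod_cast this

/-- Multiplication by `j = cτ + d` maps the lattice of `γ τ` onto that of `τ`, with `1 ↦ cτ + d` and
`γ τ ↦ aτ + b`, and `Φ(z; γ τ) = j ^ k Φ(j z; τ)`. The chain rule contributes a factor `j`, whence
the exponent `k - 1`. -/
theorem IsPeriodicPrimitive.smul {k : ℤ} {Φ : ℂ → UpperHalfPlane → ℂ} (hmod : IsModularFamily k Φ)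
    (γ : Matrix.SpecialLinearGroup (Fin 2) ℤ) {τ : UpperHalfPlane} {G : ℂ → ℂ} {ω₁ ω₂ : ℂ}
    (h : IsPeriodicPrimitive τ (fun z => Φ z τ) G ω₁ ω₂) :
    IsPeriodicPrimitive (γ • τ) (fun z => Φ z (γ • τ))
      (fun z => autFactor γ τ ^ (k - 1) * G (autFactor γ τ * z))
      (autFactor γ τ ^ (k - 1) * ((γ 1 1 : ℤ) * ω₁ + (γ 1 0 : ℤ) * ω₂))
      (autFactor γ τ ^ (k - 1) * ((γ 0 1 : ℤ) * ω₁ + (γ 0 0 : ℤ) * ω₂)) := by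
  have hj := autFactor_ne_zero γ τ
  set j := autFactor γ τ with hjdef
  have hΦ : ∀ z, Φ z (γ • τ) = j ^ k * Φ (j * z) τ := fun z => by
    rw [← hmod γ (j * z) τ, ← hjdef, mul_div_cancel_left₀ _ hj]
  have hΦ' : ∀ z, Φ z τ = j ^ (-k) * Φ (z / j) (γ • τ) := fun z => by
    rw [hΦ, mul_div_cancel₀ _ hj, ← mul_assoc, ← zpow_add₀ hj]
    simp
  have hmulan : ∀ z, AnalyticAt ℂ (fun z => j * z) z := fun z => analyticAt_const.mul analyticAt_id
  have hS : ∀ z, z ∉ singularSet (fun z => Φ z (γ • τ)) →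
      j * z ∉ singularSet (fun z => Φ z τ) := by
    intro z hz hs
    refine hs ?_
    have h1 : AnalyticAt ℂ (fun z => Φ z (γ • τ)) (j * z / j) := by
      rw [mul_div_cancel_left₀ _ hj]; exact not_not.1 hz
    have h2 : AnalyticAt ℂ (fun w : ℂ => w / j) (j * z) := analyticAt_id.div_const
    simp only [hΦ']
    exact analyticAt_const.mul (AnalyticAt.fun_comp (g := fun z => Φ z (γ • τ)) h1 h2)
  refine ⟨fun z => ?_, fun z hz => ?_, fun m n z hz => ?_⟩
  · exact (MeromorphicAt.const _ _).mul ((h.meromorphic (j * z)).comp_analyticAt (hmulan z))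
  · have h1 : HasDerivAt (fun z => j * z) (j * 1) z := (hasDerivAt_id z).const_mul j
    have h2 := ((h.hasDerivAt _ (hS z hz)).comp z h1).const_mul (j ^ (k - 1))
    refine h2.congr_deriv ?_
    rw [hΦ, zpow_sub_one₀ hj]
    field_simp
  · have e : j * (z + ((m : ℂ) + n * ((γ • τ : UpperHalfPlane) : ℂ))) =
        j * z + (((m * γ 1 1 + n * γ 0 1 : ℤ) : ℂ) + ((m * γ 1 0 + n * γ 0 0 : ℤ) : ℂ) * τ) := by
      rw [coe_smul_eq, ← hjdef]
      field_simp
      rw [hjdef, autFactor]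
      push_cast
      ring
    rw [e, h.add_period _ _ _ (hS z hz)]
    push_cast
    ring

end RegInt

/-! ### The theorem in terms of the two periods -/

theorem proposition2p15 (k : ℤ) (Φ : ℂ → UpperHalfPlane → ℂ)
    (hmero : RegInt.IsMeromorphicFamily Φ)
    (hell : RegInt.IsElliptic Φ)
    (hmod : RegInt.IsModularFamily k Φ)
    (hres : ∀ τ : UpperHalfPlane, RegInt.IsSecondKind (fun z => Φ z τ)) :
    -- the `A`-cycle integral is well defined: representatives exist and all give the same value
    (∀ τ : UpperHalfPlane, (∃ c, RegInt.IsACycle (fun z => Φ z τ) c) ∧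
      ∀ c, RegInt.IsACycle (fun z => Φ z τ) c →
        RegInt.lineIntegral (fun z => Φ z τ) c = RegInt.aCycleIntegral (fun z => Φ z τ)) ∧
    -- the regularized integral is well defined: decompositions exist and all give the same value,
    -- by an absolutely convergent integral
    (∀ τ : UpperHalfPlane,
      (∃ a b, RegInt.IsDecomposition τ (RegInt.singularSet fun z => Φ z τ)
        (RegInt.normalizedForm τ fun z => Φ z τ) a b) ∧
      ∀ a b, RegInt.IsDecomposition τ (RegInt.singularSet fun z => Φ z τ)
          (RegInt.normalizedForm τ fun z => Φ z τ) a b →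
        MeasureTheory.IntegrableOn a (RegInt.parallelogram τ) ∧
        RegInt.torusIntegral τ a =
          RegInt.regularizedIntegral τ (RegInt.singularSet fun z => Φ z τ)
            (RegInt.normalizedForm τ fun z => Φ z τ)) ∧
    -- the `A`-cycle integral is quasi-modular of weight `k`
    RegInt.IsQuasiModular k (fun τ => RegInt.aCycleIntegral (fun z => Φ z τ)) ∧
    -- its modular completion is the regularized integral
    RegInt.IsModularCompletion k (fun τ => RegInt.aCycleIntegral (fun z => Φ z τ))
      (fun τ => RegInt.regularizedIntegral τ (RegInt.singularSet fun z => Φ z τ)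
        (RegInt.normalizedForm τ fun z => Φ z τ)) ∧
    -- which is given by the following formula
    ∀ τ : UpperHalfPlane,
      RegInt.regularizedIntegral τ (RegInt.singularSet fun z => Φ z τ)
          (RegInt.normalizedForm τ fun z => Φ z τ) =
        RegInt.aCycleIntegral (fun z => Φ z τ) -
          1 / (2 * Complex.I * (τ.im : ℂ)) * (2 * Real.pi * Complex.I *
            RegInt.poincarePairing τ (fun z => Φ z τ) (fun _ => 1)) := by
  open RegInt in
  have hφ := hmero.meromorphic
  choose G ω₁ ω₂ hG using fun τ => exists_isPeriodicPrimitive (hφ τ) (hell τ) (hres τ)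
  have hA : ∀ τ, aCycleIntegral (fun z => Φ z τ) = ω₁ τ := fun τ => (hG τ).aCycleIntegral_eq (hφ τ)
  have hconj : ∀ τ : UpperHalfPlane,
      (τ : ℂ) - (starRingEnd ℂ) (τ : ℂ) = 2 * Complex.I * τ.im := fun τ => by
    rw [Complex.sub_conj]; simp; ring
  have him : ∀ τ : UpperHalfPlane, (τ.im : ℂ) ≠ 0 := fun τ => by exact_mod_cast τ.im_pos.ne'
  have hR : ∀ τ, regularizedIntegral τ (singularSet fun z => Φ z τ)
      (normalizedForm τ fun z => Φ z τ) =
        (ω₂ τ - ω₁ τ * (starRingEnd ℂ) (τ : ℂ)) / (2 * Complex.I * τ.im) := fun τ =>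
    (hG τ).regularizedIntegral_eq (hφ τ) (hell τ)
  -- The primitives at `τ` and `γ τ` are chosen independently; uniqueness of the periods makes them
  -- comparable.
  have hω : ∀ (γ : Matrix.SpecialLinearGroup (Fin 2) ℤ) (τ : UpperHalfPlane),
      ω₁ (γ • τ) = autFactor γ τ ^ (k - 1) * ((γ 1 1 : ℤ) * ω₁ τ + (γ 1 0 : ℤ) * ω₂ τ) ∧
      ω₂ (γ • τ) = autFactor γ τ ^ (k - 1) * ((γ 0 1 : ℤ) * ω₁ τ + (γ 0 0 : ℤ) * ω₂ τ) :=
    fun γ τ => (hG (γ • τ)).unique (hφ _) (hell _) ((hG τ).smul hmod γ)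
  obtain ⟨hd₁, hd₂⟩ := mdifferentiable_periods hmero hG
  have hdF : MDifferentiable 𝓘(ℂ) 𝓘(ℂ) fun τ : UpperHalfPlane => ω₂ τ - (τ : ℂ) * ω₁ τ :=
    hd₂.sub (UpperHalfPlane.mdifferentiable_coe.mul hd₁)
  have hquasi : IsQuasiModular k (fun τ => aCycleIntegral (fun z => Φ z τ)) := by
    simp only [hA]
    -- One correction term is enough, since `d ω₁ + c ω₂ = (cτ + d) ω₁ + c (ω₂ - τ ω₁)`.
    refine ⟨hd₁, 1, fun _ τ => ω₂ τ - (τ : ℂ) * ω₁ τ, fun _ => hdF, fun γ τ => ?_⟩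
    beta_reduce
    rw [(hω γ τ).1]
    have hj := autFactor_ne_zero γ τ
    simp only [Finset.Icc_self, Finset.sum_singleton, pow_one, Nat.cast_one]
    rw [zpow_sub_one₀ hj]
    field_simp
    rw [autFactor]
    ring
  refine ⟨fun τ => ⟨exists_isACycle τ (hφ τ), fun c hc => ?_⟩, fun τ => ⟨?_, fun a b hab => ?_⟩,
    hquasi, ⟨hquasi, fun γ τ => ?_, ?_⟩, fun τ => ?_⟩
  · rw [hA, (hG τ).lineIntegral_eq hc]
  · exact ⟨_, (hG τ).exists_isDecomposition (hφ τ) (hell τ)⟩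
  · rw [hR]
    exact (hG τ).torusIntegral_eq (hφ τ) (hell τ) hab
  · simp only [hR]
    -- With `j = cτ + d` and determinant `1`, the numerator `ω₂ - ω₁ τ̄` is multiplied by `j ^ (k -
    -- 1) / j̄` and the denominator `τ - τ̄` by `1 / (j j̄)`, so the quotient gains `j ^ k`.
    rw [← hconj, ← hconj, (hω γ τ).1, (hω γ τ).2, coe_smul_eq]
    have hj := autFactor_ne_zero γ τ
    have hj' : (starRingEnd ℂ) (autFactor γ τ) ≠ 0 := by simpa using hj
    have hτ : (τ : ℂ) - (starRingEnd ℂ) (τ : ℂ) ≠ 0 := by rw [hconj]; simp [him τ]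
    have hdet := det_eq_one γ
    have ej : autFactor γ τ = (γ 1 0 : ℤ) * (τ : ℂ) + (γ 1 1 : ℤ) := rfl
    have ej' : (starRingEnd ℂ) (autFactor γ τ) =
        (γ 1 0 : ℤ) * (starRingEnd ℂ) (τ : ℂ) + (γ 1 1 : ℤ) := by
      rw [ej]; simp
    simp only [map_div₀, map_add, map_mul, map_intCast]
    have e1 : (((γ 0 0 : ℤ) : ℂ) * τ + (γ 0 1 : ℤ)) / autFactor γ τ -
        ((γ 0 0 : ℤ) * (starRingEnd ℂ) (τ : ℂ) + (γ 0 1 : ℤ)) / (starRingEnd ℂ) (autFactor γ τ) =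
        ((τ : ℂ) - (starRingEnd ℂ) (τ : ℂ)) /
          (autFactor γ τ * (starRingEnd ℂ) (autFactor γ τ)) := by
      rw [div_sub_div _ _ hj hj']
      congr 1
      rw [ej', ej]
      linear_combination ((τ : ℂ) - (starRingEnd ℂ) (τ : ℂ)) * hdet
    rw [e1, zpow_sub_one₀ hj, div_div_eq_mul_div,
      ← mul_div_assoc (autFactor γ τ ^ k), div_left_inj' hτ]
    field_simp
    rw [ej']
    linear_combination (ω₂ τ - ω₁ τ * (starRingEnd ℂ) (τ : ℂ)) * hdet
  -- Writing `τ̄ = τ - 2i Im τ` gives `ω₁ + (ω₂ - τ ω₁) / (2i Im τ)`, of degree one in `1 / Im τ`.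
  · refine ⟨1, fun i τ => if i = 0 then ω₁ τ else
      (2 * Complex.I)⁻¹ * (ω₂ τ - (τ : ℂ) * ω₁ τ), fun i => ?_, by simp [hA], fun τ => ?_⟩
    · by_cases hi : i = 0
      · simpa [hi] using hd₁
      · simp only [hi, if_false]
        exact mdifferentiable_const.mul hdF
    · beta_reduce
      rw [hR, Finset.sum_range_succ, Finset.sum_range_one]
      have := him τ
      simp only [if_true, one_ne_zero, if_false, pow_zero, pow_one]
      field_simp
      linear_combination ω₁ τ * hconj τ
  · rw [hR, hA, (hG τ).legendre (hφ τ) (hell τ)]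
    have := him τ
    field_simp
    linear_combination ω₁ τ * hconj τ
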